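/- **Setting.** Let $P\subset\mathbb R^d$ be a set of $n$ points and let $0<\varepsilon_0\le 1$ be such that $1/\varepsilon_0=2^k$ for an integer $k\ge 0$. All squares (cubes) are axis-parallel, and cells are taken half-open. For a nonempty $S\subseteq P$ let $\square_S$ be a minimum bounding cube of $S$ (any fixed choice) and $\Delta_S$ its side length. *Quadtree.* The conditionally-compressed quadtree $T^*$ over $P$ has as root the cube of side length $3\Delta_P$ concentric to $\square_P$, shifted by a uniformly random vector of $[0,\Delta_P)^d$. A cell $C$ of side length $\Delta_C$, with $P'$ the set of points in it, is processed as follows. (1) If $|P'|=1$, then $C$ is a leaf. (2) If $|P'|>1$ and $\Delta_{P'}<\varepsilon_0\Delta_C/(3n^8)$, then $C$ has one child, the root of a tree built recursively by the same rules (with the same $n$) over $P'$; this root is the cube of side length $3\Delta_{P'}$ concentric to $\square_{P'}$, shifted by an independent uniformly random vector of $[0,\Delta_{P'})^d$. (3) If $|P'|>1$ and $\Delta_{P'}\ge\varepsilon_0\Delta_C/(3n^8)$, then $C$ is divided evenly into $2^d$ cubes, and those that contain a point of $P'$ are its children. *Subcells.* Each cell $C$ is divided evenly into $\varepsilon_0^{-d}$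 cubes of side length $\varepsilon_0\Delta_C$; those that contain a point of $P$ are the subcells of $C$. *Sparse graph.* The vertices of $G^*$ are the points of $P$ and one net point per subcell, located at its center. The edges are: a clique on the net points of the subcells of each cell; an edge between the net points of a subcell $\tilde C$ of $C$ and of a subcell $\tilde C^p$ of the parent cell of $C$ whenever $\tilde C\subseteq\tilde C^p$; and for each $p\in P$ an edge from $p$ to the net point of the smallest subcell that contains $p$. Edge weights are the Euclidean distances of the endpoints. *Moat event.* Let $e$ be the event that, whenever $p\in P$ lies in a cell $C$ of $T^*$ and in the subcell $\tilde C$ of $C$, the point $p$ is at distance at least $\Delta_C/n^4$ from every side of $C$ and at least $\varepsilon_0\Delta_C/n^4$ from every side of $\tilde C$. **Statement.** Let $d$ be fixed and let $f:\mathbb N\to\mathbb R$ satisfy $f(n)=o(n)$. There is a constant $K>0$ depending only on $d$ and $f$ such that for all $n$, all $P$, and all $\varepsilon_0$ as above with $\ln(1/\varepsilon_0)\le f(n)$, the event $e$ is measurable and, for all $p,q\in P$, the shortest-path distance $\mathrm{dist}_{G^*}(p,q)$ is an (a.e.) measurable random variable under the conditional law given $e$ and, if $\Pr[e]>0$, $$\mathbb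 E\bigl[\mathrm{dist}_{G^*}(p,q)\,\big|\,e\bigr]\;\le\;(1+K\,\varepsilon_0\ln n)\,\|p-q\|_2 .$$ -/

import Mathlib

open MeasureTheory ProbabilityTheory Filter Topology

namespace NetGraph

noncomputable section

/-- Points of `d`-dimensional Euclidean space. -/
abbrev Pt (d : ℕ) : Type := EuclideanSpace ℝ (Fin d)

/-- An axis-parallel cube, given by its lowest corner and its side length. -/
structure Cell (d : ℕ) where
  corner : Fin d → ℝ
  side : ℝ

namespace Cell

variable {d : ℕ}

/-- The half-open region of a cell, so that the parts of a subdivided cell partition it. -/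
def region (C : Cell d) : Set (Pt d) :=
  {x | ∀ j, C.corner j ≤ x j ∧ x j < C.corner j + C.side}

/-- The closed cube. -/
def closedRegion (C : Cell d) : Set (Pt d) :=
  {x | ∀ j, C.corner j ≤ x j ∧ x j ≤ C.corner j + C.side}

def center (C : Cell d) : Pt d :=
  WithLp.toLp 2 fun j => C.corner j + C.side / 2

/-- Divide `C` evenly into `m ^ d` cubes; this is the one with index vector `v`. -/
def part (C : Cell d) (m : ℕ) (v : Fin d → Fin m) : Cell d where
  corner j := C.corner j + ((v j : ℕ) : ℝ) * (C.side / m)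
  side := C.side / m

/-- `x` lies in the cube, at distance at least `h` from each of its sides. -/
def Within (C : Cell d) (h : ℝ) (x : Pt d) : Prop :=
  ∀ j, C.corner j + h ≤ x j ∧ x j ≤ C.corner j + C.side - h

/-- The cube concentric to `B` with three times its side length, then shifted by the vector
`B.side • u`. For `u` uniform in `[0,1)^d` the shift is uniform in `[0, B.side)^d`. -/
def tripleShift (B : Cell d) (u : Fin d → ℝ) : Cell d where
  corner j := B.corner j - B.side + u j * B.side
  side := 3 * B.side

end Cell

/-- The data of the construction: the `n` points, a rule that selects a bounding cube for every
set of points (minimum bounding cubes are not unique for `d ≥ 2`), and the exponent `k` with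
`ε₀ = 2 ^ (-k)`. -/
structure Config (n d : ℕ) where
  pt : Fin n → Pt d
  box : Finset (Fin n) → Cell d
  k : ℕ

/-- `B` is a minimum bounding cube of the points of `P` with index in `S`. -/
def IsMinBoundingCube {n d : ℕ} (pt : Fin n → Pt d) (S : Finset (Fin n)) (B : Cell d) : Prop :=
  (0 ≤ B.side ∧ ∀ i ∈ S, pt i ∈ B.closedRegion) ∧
    ∀ D : Cell d, 0 ≤ D.side → (∀ i ∈ S, pt i ∈ D.closedRegion) → B.side ≤ D.side

/-- The random choices: one vector for every set `S` of points, used for the shift of the root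
square of the quadtree built over `S`. (A quadtree is built at most once over a given `S`: inside
the quadtree over `S`, independent shifts occur for proper subsets of `S` only.) -/
abbrev Shifts (n d : ℕ) : Type := Finset (Fin n) → Fin d → ℝ

/-- All the vectors are independent and uniform in `[0,1)^d`. -/
def shiftMeasure (n d : ℕ) : Measure (Shifts n d) :=
  Measure.pi fun _ => Measure.pi fun _ => (volume : Measure ℝ).restrict (Set.Ico 0 1)

/-- The address of a quadtree node: the steps that lead to it from the root, the last one first.
`none` is the step to the single, independently shifted child; `some v` is the step to the child
cell with index `v` in the even division into `2 ^ d` cells. -/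
abbrev Address (d : ℕ) : Type := List (Option (Fin d → Fin 2))

/-- A quadtree node: its cell, and the set of points over which the tree below it is built. -/
structure Node (n d : ℕ) where
  cell : Cell d
  pts : Finset (Fin n)

/-- The vertices of the sparse graph: the points, and a net point for each pair of a quadtree node
and the index of one of the `ε₀ ^ (-d)` square regions of its cell. Pairs that do not name a node
of the tree, or name a region that is not a subcell, are isolated vertices. -/
inductive Vertex (n d k : ℕ) : Type
  | point (i : Fin n) : Vertex n d k
  | net (a : Address d) (v : Fin d → Fin (2 ^ k)) : Vertex n d k

namespace Config

variable {n d : ℕ}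

def eps (X : Config n d) : ℝ := 1 / 2 ^ X.k

open Classical in
/-- The node with a given address in the conditionally-compressed quadtree (meaningful for the
addresses that satisfy `IsNode`). -/
def node (X : Config n d) (ω : Shifts n d) : Address d → Node n d
  | [] => ⟨(X.box Finset.univ).tripleShift (ω Finset.univ), Finset.univ⟩
  | none :: a =>
      let S := (X.node ω a).pts
      ⟨(X.box S).tripleShift (ω S), S⟩
  | some v :: a =>
      let C := (X.node ω a).cell.part 2 v
      ⟨C, (X.node ω a).pts.filter fun i => X.pt i ∈ C.region⟩

/-- The node is subject to compression: the side of the bounding cube of its points is less than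
`ε₀ Δ / (3 n ^ 8)`, where `Δ` is the side of the cell. -/
def Small (X : Config n d) (N : Node n d) : Prop :=
  (X.box N.pts).side < X.eps * N.cell.side / (3 * (n : ℝ) ^ 8)

/-- The addresses of the nodes of the conditionally-compressed quadtree. A node with one point is a
leaf. A node with more points has one independently shifted child if it is subject to compression;
otherwise its children are the nonempty ones among the `2 ^ d` equal parts. -/
def IsNode (X : Config n d) (ω : Shifts n d) : Address d → Prop
  | [] => True
  | none :: a =>
      X.IsNode ω a ∧ 1 < (X.node ω a).pts.card ∧ X.Small (X.node ω a)
  | some v :: a =>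
      X.IsNode ω a ∧ 1 < (X.node ω a).pts.card ∧ ¬ X.Small (X.node ω a) ∧
        (X.node ω (some v :: a)).pts.Nonempty

/-- The square region with index `v` of the cell of the node `a`, of side `ε₀` times that of the
cell. -/
def region (X : Config n d) (ω : Shifts n d) (a : Address d) (v : Fin d → Fin (2 ^ X.k)) :
    Cell d :=
  (X.node ω a).cell.part (2 ^ X.k) v

/-- The region is a subcell: it belongs to a cell of the tree and contains one of the points. -/
def IsSubcell (X : Config n d) (ω : Shifts n d) (a : Address d) (v : Fin d → Fin (2 ^ X.k)) :
    Prop :=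
  X.IsNode ω a ∧ ∃ i, X.pt i ∈ (X.region ω a v).region

/-- The event that all points avoid the moats: a point contained in a cell of side `Δ` is at
distance at least `Δ / n ^ 4` from the sides of the cell, and at distance at least
`ε₀ Δ / n ^ 4` from the sides of the subcell that contains it. -/
def avoidsMoats (X : Config n d) : Set (Shifts n d) :=
  {ω | ∀ a, X.IsNode ω a → ∀ i, X.pt i ∈ (X.node ω a).cell.region →
    (X.node ω a).cell.Within ((X.node ω a).cell.side / (n : ℝ) ^ 4) (X.pt i) ∧
    ∀ v, X.pt i ∈ (X.region ω a v).region →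
      (X.region ω a v).Within (X.eps * (X.node ω a).cell.side / (n : ℝ) ^ 4) (X.pt i)}

/-- The position of a vertex; net points are the centers of the subcells. -/
def pos (X : Config n d) (ω : Shifts n d) : Vertex n d X.k → Pt d
  | .point i => X.pt i
  | .net a v => (X.region ω a v).center

/-- The edges of the sparse graph, in one of their two orientations. -/
inductive Edge (X : Config n d) (ω : Shifts n d) : Vertex n d X.k → Vertex n d X.k → Prop
  /-- a clique on the net points of each cell -/
  | clique (a : Address d) (v w : Fin d → Fin (2 ^ X.k)) :
      X.IsSubcell ω a v → X.IsSubcell ω a w → v ≠ w → Edge X ω (.net a v) (.net a w)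
  /-- from a net point to its parent net point -/
  | parent (s : Option (Fin d → Fin 2)) (a : Address d) (v w : Fin d → Fin (2 ^ X.k)) :
      X.IsSubcell ω (s :: a) v → X.IsSubcell ω a w →
      (X.region ω (s :: a) v).region ⊆ (X.region ω a w).region →
      Edge X ω (.net (s :: a) v) (.net a w)
  /-- from a point to the net point of the smallest subcell that contains it -/
  | point (i : Fin n) (a : Address d) (v : Fin d → Fin (2 ^ X.k)) :
      X.IsSubcell ω a v → X.pt i ∈ (X.region ω a v).region →
      (∀ b w, X.IsSubcell ω b w → X.pt i ∈ (X.region ω b w).region →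
        (X.region ω a v).side ≤ (X.region ω b w).side) →
      Edge X ω (.point i) (.net a v)

/-- The sparse graph. -/
def graph (X : Config n d) (ω : Shifts n d) : SimpleGraph (Vertex n d X.k) :=
  SimpleGraph.fromRel (X.Edge ω)

/-- The length of a walk; each edge has the Euclidean distance of its endpoints as weight. -/
def walkLength (X : Config n d) (ω : Shifts n d) {u v : Vertex n d X.k}
    (w : (X.graph ω).Walk u v) : ℝ :=
  (w.darts.map fun e => dist (X.pos ω e.fst) (X.pos ω e.snd)).sum

/-- The shortest-path distance in the sparse graph, `⊤` where there is no walk. -/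
def graphDist (X : Config n d) (ω : Shifts n d) (u v : Vertex n d X.k) : ENNReal :=
  ⨅ w : (X.graph ω).Walk u v, ENNReal.ofReal (X.walkLength ω w)

end Config

end

end NetGraph

/-! Fix shifts for which the moats are avoided, write ε for `X.eps`, and let p, q be distinct points
at distance r. Going down the quadtree, p and q are eventually separated by the division of some
cell, of side Δ. Climbing from p through the net points of its successive cells costs a geometric
series dominated by dεΔ, the same holds for q, and one clique edge joins the two sides. Hence the
graph distance is at most r + 6dεΔ (`Regular.graphDist_le`). Since p and q both keep away from the
separating hyperplane, Δ ≤ n^4 r (`side_le_of_splits`). Only O(log n) dyadic scales σ between r and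
n^4 r therefore matter. If separation at scale σ, jointly with avoidance, has probability O(r/σ)
(`measure_splits_le`), then each scale contributes O(εr) to the expectation, which is the claimed
log factor.

The difficulty in that probability is dependence: the shift of the quadtree over S decides both
whether a given cell is reached and whether its midplanes separate p from q. The remedy is
`node_stable`: when moats are avoided, moving a quadtree by less than its moats changes no point set
of its cells. So one asks only that p be reached p₀ levels higher, where 2^p₀ ≥ n^4. A dyadic cube
of shifts of side 2^(-m) that meets this event together with avoidance lies entirely in the event,
and within the cube the grid hyperplanes of level m + 1 hit the segment with the right density
(`shiftMeasure_inter_le`). Summing over S and m costs nothing: a compression shrinks cells by more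
than n^8, so cells over p of comparable size belong to one quadtree (`eq_of_mem_inTree`) and the
events are disjoint.

Conditioning costs a factor of at most two for large n. A union bound over points, over the at most
n quadtrees above each point, and over the O(n(log n + k)) grid levels (`level_le`), with moat
probability at most 12d/n^4 each, leaves a failure probability O((k + log n)/n), and k = O(f(n)) =
o(n). For the remaining bounded n the deterministic bound 1 + 6dεn^4 is absorbed into the constant.
-/

open scoped ENNReal

namespace NetGraph

noncomputable section

/-! ### Geometry of half-open cubes -/

namespace Cell

variable {d : ℕ}

@[simp] theorem part_side (C : Cell d) (m : ℕ) (v : Fin d → Fin m) :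
    (C.part m v).side = C.side / m := rfl

@[simp] theorem part_corner (C : Cell d) (m : ℕ) (v : Fin d → Fin m) (j : Fin d) :
    (C.part m v).corner j = C.corner j + ((v j : ℕ) : ℝ) * (C.side / m) := rfl

@[simp] theorem tripleShift_side (B : Cell d) (u : Fin d → ℝ) :
    (B.tripleShift u).side = 3 * B.side := rfl

@[simp] theorem tripleShift_corner (B : Cell d) (u : Fin d → ℝ) (j : Fin d) :
    (B.tripleShift u).corner j = B.corner j - B.side + u j * B.side := rfl

theorem region_subset_closedRegion (C : Cell d) : C.region ⊆ C.closedRegion :=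
  fun _ hx j => ⟨(hx j).1, (hx j).2.le⟩

theorem side_pos_of_mem_region {C : Cell d} {x : Pt d} (hx : x ∈ C.region) (j : Fin d) :
    0 < C.side := by
  have := hx j
  linarith

theorem exists_mem_region_part {C : Cell d} {x : Pt d} (hx : x ∈ C.region) {m : ℕ} (hm : 0 < m) :
    ∃ v, x ∈ (C.part m v).region := by
  have hm' : (0 : ℝ) < m := by exact_mod_cast hm
  have key : ∀ j, ∃ v : Fin m, C.corner j + ((v : ℕ) : ℝ) * (C.side / m) ≤ x j ∧
      x j < C.corner j + ((v : ℕ) : ℝ) * (C.side / m) + C.side / m := by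
    intro j
    have hs : 0 < C.side / m := div_pos (side_pos_of_mem_region hx j) hm'
    have h0 : 0 ≤ (x j - C.corner j) / (C.side / m) :=
      div_nonneg (by linarith [(hx j).1]) hs.le
    have h1 : (x j - C.corner j) / (C.side / m) < m := by
      rw [div_lt_iff₀ hs, mul_div_cancel₀ _ hm'.ne']
      linarith [(hx j).2]
    refine ⟨⟨⌊(x j - C.corner j) / (C.side / m)⌋₊, (Nat.floor_lt h0).2 h1⟩, ?_, ?_⟩
    · have := (le_div_iff₀ hs).1 (Nat.floor_le h0)
      simp only
      linarith
    · have := (div_lt_iff₀ hs).1 (Nat.lt_floor_add_one ((x j - C.corner j) / (C.side / m)))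
      simp only
      linarith
  choose v hv using key
  exact ⟨v, hv⟩

theorem part_unique {C : Cell d} {x : Pt d} {m : ℕ} {v w : Fin d → Fin m}
    (hv : x ∈ (C.part m v).region) (hw : x ∈ (C.part m w).region) : v = w := by
  funext j
  have hs : 0 < C.side / m := side_pos_of_mem_region hv j
  have h1 := hv j
  have h2 := hw j
  simp only [part_corner, part_side] at h1 h2
  have a1 : ((v j : ℕ) : ℝ) < (w j : ℕ) + 1 := by
    by_contra! h
    nlinarith
  have a2 : ((w j : ℕ) : ℝ) < (v j : ℕ) + 1 := by
    by_contra! h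
    nlinarith
  have b1 : (v j : ℕ) < (w j : ℕ) + 1 := by exact_mod_cast a1
  have b2 : (w j : ℕ) < (v j : ℕ) + 1 := by exact_mod_cast a2
  exact Fin.ext (by omega)

theorem region_part_subset (C : Cell d) {m : ℕ} (v : Fin d → Fin m) :
    (C.part m v).region ⊆ C.region := by
  intro x hx j
  have hm : 0 < m := (Nat.zero_le _).trans_lt (v j).2
  have hm' : (0 : ℝ) < m := by exact_mod_cast hm
  have hs : 0 < C.side / m := side_pos_of_mem_region hx j
  have h1 := hx j
  simp only [part_corner, part_side] at h1
  have hv : ((v j : ℕ) : ℝ) + 1 ≤ m := by exact_mod_cast (v j).2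
  have h0 : (0 : ℝ) ≤ ((v j : ℕ) : ℝ) := Nat.cast_nonneg _
  have hc : C.side = m * (C.side / m) := by field_simp
  constructor
  · nlinarith
  · nlinarith

/-- The parts of a part are contained in the parts of the cell that they meet. -/
theorem region_part_part_subset (C : Cell d) {m : ℕ} (v : Fin d → Fin 2) (w w' : Fin d → Fin m)
    {x : Pt d} (hx : x ∈ ((C.part 2 v).part m w).region) (hx' : x ∈ (C.part m w').region) :
    ((C.part 2 v).part m w).region ⊆ (C.part m w').region := by
  intro y hy j
  have hm : 0 < m := (Nat.zero_le _).trans_lt (w j).2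
  have hm' : (0 : ℝ) < m := by exact_mod_cast hm
  obtain ⟨s, hs⟩ : ∃ s, s = C.side / 2 / m := ⟨_, rfl⟩
  have e1 : C.side / m = 2 * s := by rw [hs]; field_simp
  have e2 : C.side / 2 = m * s := by rw [hs]; field_simp
  have hy := hy j
  have hx := hx j
  have hx' := hx' j
  simp only [part_corner, part_side, Nat.cast_ofNat] at hx hy hx' ⊢
  rw [← hs] at hx hy
  rw [e1] at hx' ⊢
  rw [e2] at hx hy
  have hs0 : 0 < s := by linarith
  -- In units of `s` the small part is a unit interval and the large one has length two, both with
  -- integer endpoints; overlap then forces containment.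
  have a1 : (2 * (w' j : ℕ) : ℝ) < ((v j : ℕ) : ℝ) * m + (w j : ℕ) + 1 := by
    by_contra! h
    nlinarith
  have a2 : ((v j : ℕ) : ℝ) * m + (w j : ℕ) < 2 * (w' j : ℕ) + 2 := by
    by_contra! h
    nlinarith
  have b1 : 2 * (w' j : ℕ) < (v j : ℕ) * m + (w j : ℕ) + 1 := by exact_mod_cast a1
  have b2 : (v j : ℕ) * m + (w j : ℕ) < 2 * (w' j : ℕ) + 2 := by exact_mod_cast a2
  have c1 : (2 * (w' j : ℕ) : ℝ) ≤ ((v j : ℕ) : ℝ) * m + (w j : ℕ) := by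
    exact_mod_cast (by omega : 2 * (w' j : ℕ) ≤ (v j : ℕ) * m + (w j : ℕ))
  have c2 : ((v j : ℕ) : ℝ) * m + (w j : ℕ) + 1 ≤ 2 * (w' j : ℕ) + 2 := by
    exact_mod_cast (by omega : (v j : ℕ) * m + (w j : ℕ) + 1 ≤ 2 * (w' j : ℕ) + 2)
  constructor
  · nlinarith
  · nlinarith

theorem abs_sub_le_side {C : Cell d} {x y : Pt d} (hx : x ∈ C.closedRegion)
    (hy : y ∈ C.closedRegion) (j : Fin d) : |x j - y j| ≤ C.side := by
  have h1 := hx j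
  have h2 := hy j
  rw [abs_le]
  constructor <;> linarith

theorem dist_le_of_abs_sub_le {x y : Pt d} {s : ℝ} (h : ∀ j, |x j - y j| ≤ s) :
    dist x y ≤ d * s := by
  rw [EuclideanSpace.dist_eq]
  rcases Nat.eq_zero_or_pos d with rfl | hd
  · simp
  have hs : 0 ≤ s := (abs_nonneg _).trans (h ⟨0, hd⟩)
  have hd' : (1 : ℝ) ≤ d := by exact_mod_cast hd
  apply Real.sqrt_le_iff.2 ⟨by positivity, ?_⟩
  calc ∑ i, dist (x i) (y i) ^ 2 ≤ ∑ _i : Fin d, s ^ 2 := by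
        apply Finset.sum_le_sum
        intro i _
        rw [Real.dist_eq]
        exact pow_le_pow_left₀ (abs_nonneg _) (h i) 2
    _ = d * s ^ 2 := by simp
    _ ≤ (d * s) ^ 2 := by nlinarith [sq_nonneg s, mul_nonneg (sq_nonneg s) (by linarith : (0:ℝ) ≤ d)]

theorem dist_le {C : Cell d} {x y : Pt d} (hx : x ∈ C.closedRegion) (hy : y ∈ C.closedRegion) :
    dist x y ≤ d * C.side :=
  dist_le_of_abs_sub_le (abs_sub_le_side hx hy)

theorem abs_sub_le_dist (x y : Pt d) (j : Fin d) : |x j - y j| ≤ dist x y := by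
  rw [EuclideanSpace.dist_eq]
  apply Real.le_sqrt_of_sq_le
  rw [← Real.dist_eq]
  exact Finset.single_le_sum (f := fun i => dist (x i) (y i) ^ 2) (fun i _ => sq_nonneg _)
    (Finset.mem_univ j)

theorem center_mem_closedRegion {C : Cell d} (h : 0 ≤ C.side) : C.center ∈ C.closedRegion := by
  intro j
  simp only [center]
  constructor <;> linarith

theorem center_mem_region {C : Cell d} (h : 0 < C.side) : C.center ∈ C.region := by
  intro j
  simp only [center]
  constructor <;> linarith

/-- The lower face moves out by one side and back by less than one; the upper face stays at least
one side beyond the box. -/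
theorem closedRegion_subset_tripleShift {B : Cell d} {u : Fin d → ℝ}
    (hu : ∀ j, u j ∈ Set.Ico (0 : ℝ) 1) (hB : 0 < B.side) :
    B.closedRegion ⊆ (B.tripleShift u).region := by
  intro x hx j
  have h1 := hx j
  have h2 := (hu j).1
  have h3 := (hu j).2
  simp only [tripleShift_side, tripleShift_corner]
  constructor <;> nlinarith

/-- A cube contained in the interior of a cell, away from the moat, if it is small and contains
a point away from the moat. -/
theorem region_subset_of_within {C D : Cell d} {h : ℝ} {x : Pt d} (hC : C.Within h x)
    (hx : x ∈ D.region) (hD : D.side ≤ h) : D.region ⊆ C.region := by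
  intro y hy j
  have h1 := hC j
  have h2 := hx j
  have h3 := hy j
  constructor <;> linarith

/-- A cube translated by less than the width of the moat keeps the points that avoid it. This drives
the stability of the quadtree. -/
theorem mem_region_of_within {C D : Cell d} {h : ℝ} {x : Pt d}
    (hx : C.Within h x) (hs : D.side = C.side) (hc : ∀ l, |D.corner l - C.corner l| < h) :
    x ∈ D.region := by
  intro l
  have h1 := hx l
  have h2 := abs_lt.1 (hc l)
  rw [hs]
  constructor <;> linarith

end Cell


/-! ### Combinatorial structure of the quadtree -/

/-- The number of divisions since the last root of a (sub-)quadtree. -/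
def level {d : ℕ} : Address d → ℕ
  | [] => 0
  | none :: _ => 0
  | some _ :: a => level a + 1

namespace Config

variable {n d : ℕ}

/-- The standing assumptions: at least two points, all distinct, and minimum bounding cubes. -/
structure Regular (X : Config n d) : Prop where
  two_le : 2 ≤ n
  inj : Function.Injective X.pt
  minBox : ∀ S : Finset (Fin n), S.Nonempty → IsMinBoundingCube X.pt S (X.box S)

/-- The set of points over which the innermost quadtree that contains the node `a` is built. -/
def rootSet (X : Config n d) (ω : Shifts n d) : Address d → Finset (Fin n)
  | [] => Finset.univ
  | none :: a => (X.node ω a).pts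
  | some _ :: a => X.rootSet ω a

/-- The points avoid the moats of the cell of the node `a` and of its subcells. -/
def Clear (X : Config n d) (ω : Shifts n d) (a : Address d) : Prop :=
  ∀ i, X.pt i ∈ (X.node ω a).cell.region →
    (X.node ω a).cell.Within ((X.node ω a).cell.side / (n : ℝ) ^ 4) (X.pt i) ∧
    ∀ v, X.pt i ∈ (X.region ω a v).region →
      (X.region ω a v).Within (X.eps * (X.node ω a).cell.side / (n : ℝ) ^ 4) (X.pt i)

/-- The shifts all of whose coordinates lie in `[0,1)`. -/
def unitShifts (n d : ℕ) : Set (Shifts n d) :=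
  {ω | ∀ S j, ω S j ∈ Set.Ico (0 : ℝ) 1}

variable {X : Config n d} {ω : Shifts n d}

theorem eps_pos (X : Config n d) : 0 < X.eps := by unfold eps; positivity

theorem eps_le_one (X : Config n d) : X.eps ≤ 1 := by
  unfold eps
  rw [div_le_one (by positivity)]
  exact one_le_pow₀ (by norm_num)

namespace Regular

variable (hX : X.Regular)
include hX

theorem cast_pos : (0 : ℝ) < n := by
  have := hX.two_le
  exact_mod_cast (by omega : 0 < n)

theorem two_le_cast : (2 : ℝ) ≤ n := by exact_mod_cast hX.two_le

theorem width_nonneg {S : Finset (Fin n)} (hS : S.Nonempty) : 0 ≤ (X.box S).side :=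
  (hX.minBox S hS).1.1

theorem mem_box {S : Finset (Fin n)} {i : Fin n} (hi : i ∈ S) :
    X.pt i ∈ (X.box S).closedRegion :=
  (hX.minBox S ⟨i, hi⟩).1.2 i hi

theorem width_le {S : Finset (Fin n)} (hS : S.Nonempty) {C : Cell d} (h0 : 0 ≤ C.side)
    (hC : ∀ i ∈ S, X.pt i ∈ C.closedRegion) : (X.box S).side ≤ C.side :=
  (hX.minBox S hS).2 C h0 hC

theorem exists_coord_ne {i j : Fin n} (hij : i ≠ j) : ∃ l, X.pt i l ≠ X.pt j l := by
  by_contra! h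
  exact hij (hX.inj (PiLp.ext h))

theorem width_pos {S : Finset (Fin n)} (hS : 1 < S.card) : 0 < (X.box S).side := by
  obtain ⟨i, hi, j, hj, hij⟩ := Finset.one_lt_card.1 hS
  obtain ⟨l, hl⟩ := hX.exists_coord_ne hij
  have := Cell.abs_sub_le_side (hX.mem_box hi) (hX.mem_box hj) l
  exact (abs_pos.2 (sub_ne_zero.2 hl)).trans_le this

end Regular

theorem node_side (X : Config n d) (ω : Shifts n d) (a : Address d) :
    (X.node ω a).cell.side = 3 * (X.box (X.rootSet ω a)).side / 2 ^ level a := by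
  induction a with
  | nil => simp [node, rootSet, level]
  | cons s a ih =>
    cases s with
    | none => simp [node, rootSet, level]
    | some v =>
      simp only [node, rootSet, level, Cell.part_side, ih, pow_succ]
      push_cast
      rw [div_div]

/-- All cells of one level of a quadtree lie on a common grid whose offset is the shift of the root;
the path only determines the integer vector. -/
theorem node_corner (X : Config n d) (ω : Shifts n d) (a : Address d) :
    ∃ c : Fin d → ℤ, ∀ j, (X.node ω a).cell.corner j =
      (X.box (X.rootSet ω a)).corner j - (X.box (X.rootSet ω a)).side +
        ω (X.rootSet ω a) j * (X.box (X.rootSet ω a)).side +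
        c j * (3 * (X.box (X.rootSet ω a)).side / 2 ^ level a) := by
  induction a with
  | nil => exact ⟨0, by simp [node, rootSet, level]⟩
  | cons s a ih =>
    cases s with
    | none => exact ⟨0, by simp [node, rootSet, level]⟩
    | some v =>
      obtain ⟨c, hc⟩ := ih
      refine ⟨fun j => 2 * c j + (v j : ℕ), fun j => ?_⟩
      simp only [node, rootSet, level, Cell.part_corner, hc, node_side, pow_succ]
      push_cast
      ring

theorem mem_pts_some {a : Address d} {v : Fin d → Fin 2} {i : Fin n} :
    i ∈ (X.node ω (some v :: a)).pts ↔
      i ∈ (X.node ω a).pts ∧ X.pt i ∈ ((X.node ω a).cell.part 2 v).region := by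
  simp [node]

theorem pts_cons_subset (s : Option (Fin d → Fin 2)) (a : Address d) :
    (X.node ω (s :: a)).pts ⊆ (X.node ω a).pts := by
  cases s with
  | none => simp [node]
  | some v => exact fun i hi => (mem_pts_some.1 hi).1

theorem pts_subset_rootSet (a : Address d) : (X.node ω a).pts ⊆ X.rootSet ω a := by
  induction a with
  | nil => simp [rootSet]
  | cons s a ih =>
    cases s with
    | none => simp [node, rootSet]
    | some v => exact (pts_cons_subset _ a).trans ih

theorem IsNode.tail {s : Option (Fin d → Fin 2)} {a : Address d} (h : X.IsNode ω (s :: a)) :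
    X.IsNode ω a := by
  cases s <;> exact h.1

theorem IsNode.one_lt_card {s : Option (Fin d → Fin 2)} {a : Address d}
    (h : X.IsNode ω (s :: a)) : 1 < (X.node ω a).pts.card := by
  cases s <;> exact h.2.1

theorem IsNode.of_suffix {a b : Address d} (hb : X.IsNode ω b) (h : a <:+ b) :
    X.IsNode ω a := by
  induction b with
  | nil => rw [List.suffix_nil.1 h]; trivial
  | cons s b ih =>
    rcases List.suffix_cons_iff.1 h with rfl | h
    · exact hb
    · exact ih hb.tail h

theorem pts_subset_of_suffix {a b : Address d} (h : a <:+ b) :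
    (X.node ω b).pts ⊆ (X.node ω a).pts := by
  induction b with
  | nil => rw [List.suffix_nil.1 h]
  | cons s b ih =>
    rcases List.suffix_cons_iff.1 h with rfl | h
    · rfl
    · exact (pts_cons_subset s b).trans (ih h)

/-- There is at most one node of each depth over a given point. -/
theorem IsNode.eq_of_length_eq {i : Fin n} {a b : Address d} (ha : X.IsNode ω a)
    (hb : X.IsNode ω b) (hia : i ∈ (X.node ω a).pts) (hib : i ∈ (X.node ω b).pts)
    (h : a.length = b.length) : a = b := by
  induction a generalizing b with
  | nil => exact (List.length_eq_zero_iff.1 h.symm).symm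
  | cons s a ih =>
    cases b with
    | nil => simp at h
    | cons t b =>
      obtain rfl := ih ha.tail hb.tail (pts_cons_subset _ _ hia) (pts_cons_subset _ _ hib)
        (by simpa using h)
      cases s with
      | none =>
        cases t with
        | none => rfl
        | some w => exact absurd ha.2.2 hb.2.2.1
      | some v =>
        cases t with
        | none => exact absurd hb.2.2 ha.2.2.1
        | some w =>
          rw [Cell.part_unique (mem_pts_some.1 hia).2 (mem_pts_some.1 hib).2]

/-- The nodes over a fixed point form a single chain, so any two are comparable by their depth. -/
theorem IsNode.suffix_of_length_le {i : Fin n} {a b : Address d} (ha : X.IsNode ω a)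
    (hb : X.IsNode ω b) (hia : i ∈ (X.node ω a).pts) (hib : i ∈ (X.node ω b).pts)
    (h : a.length ≤ b.length) : a <:+ b := by
  have hs : b.drop (b.length - a.length) <:+ b := List.drop_suffix _ _
  rw [ha.eq_of_length_eq (hb.of_suffix hs) hia (pts_subset_of_suffix hs hib)
    (by rw [List.length_drop]; omega)]
  exact hs

namespace Regular

variable (hX : X.Regular)
include hX

theorem pts_nonempty {a : Address d} (ha : X.IsNode ω a) : (X.node ω a).pts.Nonempty := by
  cases a with
  | nil => exact ⟨⟨0, by have := hX.two_le; omega⟩, Finset.mem_univ _⟩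
  | cons s a =>
    cases s with
    | none => exact Finset.card_pos.1 ((Nat.zero_lt_one).trans ha.2.1)
    | some v => exact ha.2.2.2

theorem one_lt_card_rootSet {a : Address d} (ha : X.IsNode ω a) :
    1 < (X.rootSet ω a).card := by
  induction a with
  | nil => simpa [rootSet] using (show 1 < n from hX.two_le)
  | cons s a ih =>
    cases s with
    | none => exact ha.2.1
    | some v => exact ih ha.1

theorem rootWidth_pos {a : Address d} (ha : X.IsNode ω a) :
    0 < (X.box (X.rootSet ω a)).side :=
  hX.width_pos (hX.one_lt_card_rootSet ha)

theorem side_pos {a : Address d} (ha : X.IsNode ω a) : 0 < (X.node ω a).cell.side := by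
  rw [node_side]
  have := hX.rootWidth_pos ha
  positivity

/-- The 3 in the compression threshold cancels the enlargement of the bounding cube to the new root.
-/
theorem pow_mul_side_none_lt {a : Address d} (ha : X.IsNode ω (none :: a)) :
    (n : ℝ) ^ 8 * (X.node ω (none :: a)).cell.side < X.eps * (X.node ω a).cell.side := by
  have h := ha.2.2
  have hn := hX.cast_pos
  unfold Small at h
  rw [lt_div_iff₀ (by positivity)] at h
  simp only [node, Cell.tripleShift_side]
  linarith

theorem side_cons_le {s : Option (Fin d → Fin 2)} {a : Address d} (ha : X.IsNode ω (s :: a)) :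
    (X.node ω (s :: a)).cell.side ≤ (X.node ω a).cell.side / 2 := by
  cases s with
  | some v => simp [node]
  | none =>
    have h1 := hX.pow_mul_side_none_lt ha
    have h2 : (2 : ℝ) ≤ (n : ℝ) ^ 8 := by
      calc (2 : ℝ) ≤ 2 ^ 8 := by norm_num
        _ ≤ _ := pow_le_pow_left₀ (by norm_num) hX.two_le_cast 8
    have h3 := hX.side_pos ha
    have h4 := hX.side_pos ha.tail
    have h5 := X.eps_le_one
    nlinarith

theorem side_le_of_suffix {a b : Address d} (hb : X.IsNode ω b) (h : a <:+ b) :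
    (X.node ω b).cell.side ≤ (X.node ω a).cell.side := by
  induction b with
  | nil => rw [List.suffix_nil.1 h]
  | cons s b ih =>
    rcases List.suffix_cons_iff.1 h with rfl | h
    · rfl
    · have h1 := hX.side_cons_le hb
      have h2 := hX.side_pos hb.tail
      linarith [ih hb.tail h]

theorem side_mul_two_pow_le {a : Address d} (ha : X.IsNode ω a) :
    (X.node ω a).cell.side * 2 ^ a.length ≤ 3 * (X.box Finset.univ).side := by
  induction a with
  | nil => simp [node]
  | cons s a ih =>
    have h1 := hX.side_cons_le ha
    have h2 := ih ha.tail
    rw [List.length_cons, pow_succ]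
    have : (0 : ℝ) < 2 ^ a.length := by positivity
    nlinarith

/-- A quadtree over `S` is entered only from cells of quadtrees over other sets. -/
theorem rootSet_ne_pts {a : Address d} (ha : X.IsNode ω a) (hs : X.Small (X.node ω a)) :
    X.rootSet ω a ≠ (X.node ω a).pts := by
  intro h
  have hw := hX.rootWidth_pos ha
  have hn := hX.cast_pos
  unfold Small at hs
  rw [lt_div_iff₀ (by positivity), node_side, ← h] at hs
  have h1 : 3 * (X.box (X.rootSet ω a)).side / 2 ^ level a ≤ 3 * (X.box (X.rootSet ω a)).side :=
    div_le_self (by positivity) (one_le_pow₀ (by norm_num))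
  have h2 : (1 : ℝ) ≤ (n : ℝ) ^ 8 := one_le_pow₀ (by linarith [hX.two_le_cast])
  have h3 := X.eps_le_one
  have h4 := X.eps_pos
  have h5 : 0 ≤ 3 * (X.box (X.rootSet ω a)).side / 2 ^ level a := by positivity
  nlinarith

/-- Two nodes over a common point that belong to different quadtrees differ a lot in size. -/
theorem pow_mul_side_lt_of_rootSet_ne {a b : Address d} (hb : X.IsNode ω b) (h : a <:+ b)
    (hne : X.rootSet ω a ≠ X.rootSet ω b) :
    (n : ℝ) ^ 8 * (X.node ω b).cell.side < (X.node ω a).cell.side := by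
  have hn := hX.cast_pos
  induction b with
  | nil => rw [List.suffix_nil.1 h] at hne; exact absurd rfl hne
  | cons s b ih =>
    rcases List.suffix_cons_iff.1 h with rfl | h'
    · exact absurd rfl hne
    cases s with
    | none =>
      have h1 := hX.pow_mul_side_none_lt hb
      have h2 := hX.side_le_of_suffix hb.tail h'
      have h3 := X.eps_le_one
      have h4 := hX.side_pos hb.tail
      nlinarith
    | some v =>
      have h1 := ih hb.tail h' hne
      have h2 := hX.side_cons_le hb
      have h3 := hX.side_pos hb.tail
      refine lt_of_le_of_lt ?_ h1
      gcongr
      linarith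

theorem mem_region_of_mem_pts (hω : ω ∈ unitShifts n d) {a : Address d} (ha : X.IsNode ω a)
    {i : Fin n} (hi : i ∈ (X.node ω a).pts) : X.pt i ∈ (X.node ω a).cell.region := by
  cases a with
  | nil =>
    exact Cell.closedRegion_subset_tripleShift (hω _) (hX.rootWidth_pos ha) (hX.mem_box hi)
  | cons s a =>
    cases s with
    | none =>
      exact Cell.closedRegion_subset_tripleShift (hω _) (hX.rootWidth_pos ha) (hX.mem_box hi)
    | some v => exact (mem_pts_some.1 hi).2

theorem width_pts_le_side (hω : ω ∈ unitShifts n d) {a : Address d} (ha : X.IsNode ω a) :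
    (X.box (X.node ω a).pts).side ≤ (X.node ω a).cell.side :=
  hX.width_le (hX.pts_nonempty ha) (hX.side_pos ha).le fun _ hi =>
    Cell.region_subset_closedRegion _ (hX.mem_region_of_mem_pts hω ha hi)

theorem exists_child (hω : ω ∈ unitShifts n d) {a : Address d} (ha : X.IsNode ω a)
    (hc : 1 < (X.node ω a).pts.card) {i : Fin n} (hi : i ∈ (X.node ω a).pts) :
    ∃ s, X.IsNode ω (s :: a) ∧ i ∈ (X.node ω (s :: a)).pts := by
  by_cases hs : X.Small (X.node ω a)
  · exact ⟨none, ⟨ha, hc, hs⟩, hi⟩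
  · obtain ⟨v, hv⟩ := Cell.exists_mem_region_part (hX.mem_region_of_mem_pts hω ha hi) two_pos
    have : i ∈ (X.node ω (some v :: a)).pts := mem_pts_some.2 ⟨hi, hv⟩
    exact ⟨some v, ⟨ha, hc, hs, ⟨i, this⟩⟩, this⟩

/-- A compressed child is no wider than the moat of a subcell of its parent, so once it contains a
clear point it cannot cross the boundary of that point's subcell. -/
theorem small_moat {a : Address d} (ha : X.IsNode ω (none :: a)) :
    (X.node ω (none :: a)).cell.side ≤ X.eps * (X.node ω a).cell.side / (n : ℝ) ^ 4 := by
  have h1 := hX.pow_mul_side_none_lt ha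
  have hn := hX.cast_pos
  have h3 := hX.side_pos ha
  rw [le_div_iff₀ (by positivity)]
  have h2 : (n : ℝ) ^ 4 ≤ (n : ℝ) ^ 8 :=
    pow_le_pow_right₀ (by linarith [hX.two_le_cast]) (by norm_num)
  nlinarith

/-- If the moats of all larger cells are avoided, then the points of a node are exactly the
points in its cell. -/
theorem mem_pts_of_mem_region (hω : ω ∈ unitShifts n d) {a : Address d} (ha : X.IsNode ω a)
    (hclear : ∀ b : Address d, b.length < a.length → X.IsNode ω b → X.Clear ω b)
    {i : Fin n} (hi : X.pt i ∈ (X.node ω a).cell.region) : i ∈ (X.node ω a).pts := by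
  induction a with
  | nil => exact Finset.mem_univ i
  | cons s a ih =>
    have ih := ih ha.tail fun b hb => hclear b (hb.trans (by simp))
    cases s with
    | some v => exact mem_pts_some.2 ⟨ih (Cell.region_part_subset _ v hi), hi⟩
    | none =>
      obtain ⟨l, hl⟩ := hX.pts_nonempty ha
      have h1 := hX.mem_region_of_mem_pts hω ha hl
      have h2 := (hclear a (by simp) ha.1 l (hX.mem_region_of_mem_pts hω ha.1 hl)).1
      -- The shifted cell sits inside its parent's cell, so the point already lies there, and
      -- compression does not change the point set.
      refine ih (Cell.region_subset_of_within h2 h1 ((hX.small_moat ha).trans ?_) hi)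
      gcongr
      have := X.eps_le_one
      have := hX.side_pos ha.1
      nlinarith

end Regular

end Config


/-! ### Short paths in the sparse graph when moats are avoided -/

namespace Config

variable {n d : ℕ} {X : Config n d} {ω : Shifts n d}

/-- The cell of the node `a` is divided, and the points `i` and `j` are separated. -/
def Splits (X : Config n d) (ω : Shifts n d) (i j : Fin n) (a : Address d) : Prop :=
  X.IsNode ω a ∧ i ∈ (X.node ω a).pts ∧ j ∈ (X.node ω a).pts ∧ ¬ X.Small (X.node ω a) ∧
    ∃ v w, v ≠ w ∧ X.pt i ∈ ((X.node ω a).cell.part 2 v).region ∧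
      X.pt j ∈ ((X.node ω a).cell.part 2 w).region

/-- There is a walk of length at most `L`. -/
def Joined (X : Config n d) (ω : Shifts n d) (u v : Vertex n d X.k) (L : ℝ) : Prop :=
  ∃ w : (X.graph ω).Walk u v, X.walkLength ω w ≤ L

theorem Joined.refl (u : Vertex n d X.k) : X.Joined ω u u 0 :=
  ⟨.nil, by simp [walkLength]⟩

theorem Joined.symm {u v : Vertex n d X.k} {L : ℝ} (h : X.Joined ω u v L) :
    X.Joined ω v u L := by
  obtain ⟨w, hw⟩ := h
  refine ⟨w.reverse, le_trans (le_of_eq ?_) hw⟩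
  unfold walkLength
  rw [SimpleGraph.Walk.darts_reverse, List.map_reverse, List.sum_reverse, List.map_map]
  congr 1
  apply List.map_congr_left
  intro e _
  simp [dist_comm]

theorem Joined.trans {u v w : Vertex n d X.k} {L M : ℝ} (h : X.Joined ω u v L)
    (h' : X.Joined ω v w M) : X.Joined ω u w (L + M) := by
  obtain ⟨p, hp⟩ := h
  obtain ⟨q, hq⟩ := h'
  refine ⟨p.append q, ?_⟩
  have : X.walkLength ω (p.append q) = X.walkLength ω p + X.walkLength ω q := by
    simp [walkLength, SimpleGraph.Walk.darts_append]
  linarith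

theorem Joined.mono {u v : Vertex n d X.k} {L M : ℝ} (h : X.Joined ω u v L) (hLM : L ≤ M) :
    X.Joined ω u v M := by
  obtain ⟨p, hp⟩ := h
  exact ⟨p, hp.trans hLM⟩

theorem Joined.of_edge {u v : Vertex n d X.k} (hne : u ≠ v) (h : X.Edge ω u v) :
    X.Joined ω u v (dist (X.pos ω u) (X.pos ω v)) := by
  have hadj : (X.graph ω).Adj u v := by
    unfold graph
    rw [SimpleGraph.fromRel_adj]
    exact ⟨hne, Or.inl h⟩
  exact ⟨.cons hadj .nil, by simp [walkLength]⟩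

theorem Joined.graphDist_le {u v : Vertex n d X.k} {L : ℝ} (h : X.Joined ω u v L) :
    X.graphDist ω u v ≤ ENNReal.ofReal L := by
  obtain ⟨w, hw⟩ := h
  exact (iInf_le _ w).trans (ENNReal.ofReal_le_ofReal hw)

theorem region_side (X : Config n d) (ω : Shifts n d) (a : Address d)
    (v : Fin d → Fin (2 ^ X.k)) :
    (X.region ω a v).side = X.eps * (X.node ω a).cell.side := by
  unfold region eps
  rw [Cell.part_side]
  push_cast
  ring

theorem exists_mem_region {a : Address d} {i : Fin n}
    (h : X.pt i ∈ (X.node ω a).cell.region) : ∃ v, X.pt i ∈ (X.region ω a v).region :=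
  Cell.exists_mem_region_part h (by positivity)

theorem isSubcell_of_mem {a : Address d} {v : Fin d → Fin (2 ^ X.k)} {i : Fin n}
    (ha : X.IsNode ω a) (h : X.pt i ∈ (X.region ω a v).region) : X.IsSubcell ω a v :=
  ⟨ha, i, h⟩

namespace Regular

variable (hX : X.Regular)
include hX

/-- Cells over more than one point occur down to a bounded depth only. -/
theorem exists_depth_bound (hω : ω ∈ unitShifts n d) :
    ∃ N : ℕ, ∀ a : Address d, X.IsNode ω a → 1 < (X.node ω a).pts.card → a.length < N := by
  -- The least box side over sets of at least two points bounds from below every cell with several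
  -- points, while each step down at least halves the side.
  obtain ⟨S, hS, hmin⟩ := Finset.exists_min_image
    ((Finset.univ : Finset (Finset (Fin n))).filter fun S => 1 < S.card)
    (fun S => (X.box S).side)
    ⟨Finset.univ, by simpa using (show 1 < n from hX.two_le)⟩
  have hδ : 0 < (X.box S).side := hX.width_pos (Finset.mem_filter.1 hS).2
  obtain ⟨N, hN⟩ := pow_unbounded_of_one_lt (3 * (X.box Finset.univ).side / (X.box S).side)
    (one_lt_two)
  refine ⟨N, fun a ha hc => ?_⟩
  have h1 := hmin (X.node ω a).pts (by simpa using hc)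
  have h2 := hX.width_pts_le_side hω ha
  have h3 := hX.side_mul_two_pow_le ha
  rw [div_lt_iff₀ hδ] at hN
  have h4 : (0 : ℝ) < 2 ^ a.length := by positivity
  have : (2 : ℝ) ^ a.length < 2 ^ N := by
    by_contra! h
    nlinarith [mul_le_mul h (h1.trans h2) hδ.le (by positivity)]
  exact (pow_lt_pow_iff_right₀ (one_lt_two : (1 : ℝ) < 2)).1 this

variable (hω : ω ∈ unitShifts n d) (he : ω ∈ X.avoidsMoats)
include hω he

theorem mem_pts_iff {a : Address d} (ha : X.IsNode ω a) {i : Fin n} :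
    i ∈ (X.node ω a).pts ↔ X.pt i ∈ (X.node ω a).cell.region :=
  ⟨hX.mem_region_of_mem_pts hω ha, hX.mem_pts_of_mem_region hω ha fun b _ hb => he b hb⟩

omit hω in
-- For a division the two subcell grids are nested; for a compression the whole child cell fits
-- within the moat of the parent's subcell. This supplies the containment that parent edges require.
theorem region_subset_region {s : Option (Fin d → Fin 2)} {a : Address d}
    (ha : X.IsNode ω (s :: a)) {i : Fin n} {v w : Fin d → Fin (2 ^ X.k)}
    (hv : X.pt i ∈ (X.region ω (s :: a) v).region) (hw : X.pt i ∈ (X.region ω a w).region) :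
    (X.region ω (s :: a) v).region ⊆ (X.region ω a w).region := by
  cases s with
  | some u => exact Cell.region_part_part_subset _ u v w hv hw
  | none =>
    have h1 := (he a ha.1 i (Cell.region_part_subset _ w hw)).2 w hw
    exact (Cell.region_part_subset _ v).trans
      (Cell.region_subset_of_within h1 (Cell.region_part_subset _ v hv) (hX.small_moat ha))

omit hω in
theorem joined_parent {s : Option (Fin d → Fin 2)} {a : Address d}
    (ha : X.IsNode ω (s :: a)) {i : Fin n} {v w : Fin d → Fin (2 ^ X.k)}
    (hv : X.pt i ∈ (X.region ω (s :: a) v).region) (hw : X.pt i ∈ (X.region ω a w).region) :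
    X.Joined ω (.net (s :: a) v) (.net a w) (d * (X.eps * (X.node ω a).cell.side)) := by
  have hsub := hX.region_subset_region he ha hv hw
  refine (Joined.of_edge ?_ (.parent s a v w (isSubcell_of_mem ha hv)
    (isSubcell_of_mem ha.tail hw) hsub)).mono ?_
  · intro h
    simpa using (Vertex.net.inj h).1
  · rw [← region_side X ω a w]
    have h1 := X.eps_pos
    refine Cell.dist_le (Cell.region_subset_closedRegion _ (hsub (Cell.center_mem_region ?_)))
      (Cell.center_mem_closedRegion ?_)
    · rw [region_side]
      exact mul_pos h1 (hX.side_pos ha)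
    · rw [region_side]
      exact (mul_pos h1 (hX.side_pos ha.tail)).le

/-- A subcell containing the point belongs to a node whose point set contains it, hence to the chain
of nodes over the point. A node with a single point ends this chain, so its subcell is smallest. -/
theorem joined_leaf {a : Address d} (ha : X.IsNode ω a) {i : Fin n}
    (hi : i ∈ (X.node ω a).pts) (hc : ¬ 1 < (X.node ω a).pts.card)
    {v : Fin d → Fin (2 ^ X.k)} (hv : X.pt i ∈ (X.region ω a v).region) :
    X.Joined ω (.point i) (.net a v) (d * (X.eps * (X.node ω a).cell.side)) := by
  have hmin : ∀ b w, X.IsSubcell ω b w → X.pt i ∈ (X.region ω b w).region →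
      (X.region ω a v).side ≤ (X.region ω b w).side := by
    intro b w hb hbi
    have hib := (hX.mem_pts_iff hω he hb.1).2 (Cell.region_part_subset _ w hbi)
    have hlen : b.length ≤ a.length := by
      by_contra! h
      have hs := ha.suffix_of_length_le hb.1 hi hib h.le
      obtain ⟨t, rfl⟩ := hs
      rcases List.eq_nil_or_concat t with rfl | ⟨t, s, rfl⟩
      · simp at h
      · have : X.IsNode ω (s :: a) := hb.1.of_suffix ⟨t, by simp⟩
        exact hc this.one_lt_card
    rw [region_side, region_side]
    have := hX.side_le_of_suffix ha (hb.1.suffix_of_length_le ha hib hi hlen)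
    have := X.eps_pos
    gcongr
  refine (Joined.of_edge (by simp) (.point i a v (isSubcell_of_mem ha hv) hv hmin)).mono ?_
  rw [← region_side X ω a v]
  refine Cell.dist_le (Cell.region_subset_closedRegion _ hv) (Cell.center_mem_closedRegion ?_)
  rw [region_side]
  exact (mul_pos X.eps_pos (hX.side_pos ha)).le

/-- The path from a point through the net points of its cells. -/
theorem joined_net {a : Address d} (ha : X.IsNode ω a) {i : Fin n}
    (hi : i ∈ (X.node ω a).pts) {v : Fin d → Fin (2 ^ X.k)}
    (hv : X.pt i ∈ (X.region ω a v).region) :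
    X.Joined ω (.point i) (.net a v) (2 * (d * (X.eps * (X.node ω a).cell.side))) := by
  obtain ⟨N, hN⟩ := hX.exists_depth_bound hω
  -- Induction on the remaining depth: at depth `N` or more a node has a single point.
  obtain ⟨m, hm⟩ : ∃ m, N ≤ a.length + m := ⟨N, by omega⟩
  have he0 := X.eps_pos
  induction m generalizing a v with
  | zero =>
    have hc : ¬ 1 < (X.node ω a).pts.card := fun hc => by
      have := hN a ha hc
      omega
    refine (hX.joined_leaf hω he ha hi hc hv).mono ?_
    have := hX.side_pos ha
    have : 0 ≤ d * (X.eps * (X.node ω a).cell.side) := by positivity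
    linarith
  | succ m ih =>
    have hs := hX.side_pos ha
    by_cases hc : 1 < (X.node ω a).pts.card
    · obtain ⟨s, hsa, his⟩ := hX.exists_child hω ha hc hi
      obtain ⟨w, hw⟩ := exists_mem_region (hX.mem_region_of_mem_pts hω hsa his)
      refine ((ih hsa his hw (by simp only [List.length_cons]; omega)).trans
        (hX.joined_parent he hsa hw hv)).mono ?_
      -- Geometric series: twice the child's cost is at most one parent cost, and the parent edge
      -- adds one more.
      have h1 := hX.side_cons_le hsa
      have h2 : d * (X.eps * (X.node ω (s :: a)).cell.side) ≤
          d * (X.eps * ((X.node ω a).cell.side / 2)) := by gcongr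
      linarith
    · refine (hX.joined_leaf hω he ha hi hc hv).mono ?_
      have : 0 ≤ d * (X.eps * (X.node ω a).cell.side) := by positivity
      linarith

omit he in
-- Two distinct points kept together make the node non-leaf, and non-leaf nodes have bounded depth.
theorem exists_splits {i j : Fin n} (hij : i ≠ j) : ∃ a, X.Splits ω i j a := by
  obtain ⟨N, hN⟩ := hX.exists_depth_bound hω
  have key : ∀ m, (∃ a, X.Splits ω i j a) ∨
      ∃ a : Address d, X.IsNode ω a ∧ i ∈ (X.node ω a).pts ∧ j ∈ (X.node ω a).pts ∧
        a.length = m := by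
    intro m
    induction m with
    | zero => exact Or.inr ⟨[], trivial, Finset.mem_univ _, Finset.mem_univ _, rfl⟩
    | succ m ih =>
      rcases ih with h | ⟨a, ha, hi, hj, hm⟩
      · exact Or.inl h
      have hc : 1 < (X.node ω a).pts.card := Finset.one_lt_card.2 ⟨i, hi, j, hj, hij⟩
      by_cases hs : X.Small (X.node ω a)
      · exact Or.inr ⟨none :: a, ⟨ha, hc, hs⟩, hi, hj, by simp [hm]⟩
      · obtain ⟨v, hv⟩ := Cell.exists_mem_region_part (hX.mem_region_of_mem_pts hω ha hi) two_pos
        obtain ⟨w, hw⟩ := Cell.exists_mem_region_part (hX.mem_region_of_mem_pts hω ha hj) two_pos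
        by_cases hvw : v = w
        · subst hvw
          have hi' := mem_pts_some.2 ⟨hi, hv⟩
          exact Or.inr ⟨some v :: a, ⟨ha, hc, hs, ⟨i, hi'⟩⟩, hi', mem_pts_some.2 ⟨hj, hw⟩,
            by simp [hm]⟩
        · exact Or.inl ⟨a, ha, hi, hj, hs, v, w, hvw, hv, hw⟩
  rcases key N with h | ⟨a, ha, hi, hj, hm⟩
  · exact h
  · exact absurd (hN a ha (Finset.one_lt_card.2 ⟨i, hi, j, hj, hij⟩)) (by omega)

/-- The constant 6 is 2 for each climb, plus 2 for moving both endpoints of the clique edge from the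
points to their net points. -/
theorem graphDist_le {i j : Fin n} {a : Address d} (h : X.Splits ω i j a) :
    X.graphDist ω (.point i) (.point j) ≤
      ENNReal.ofReal (dist (X.pt i) (X.pt j) + 6 * d * X.eps * (X.node ω a).cell.side) := by
  obtain ⟨ha, hi, hj, -, -⟩ := h
  obtain ⟨v, hv⟩ := exists_mem_region (hX.mem_region_of_mem_pts hω ha hi)
  obtain ⟨w, hw⟩ := exists_mem_region (hX.mem_region_of_mem_pts hω ha hj)
  have hs := hX.side_pos ha
  have he0 := X.eps_pos
  have hmid : X.Joined ω (.net a v) (.net a w)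
      (dist (X.pt i) (X.pt j) + 2 * (d * (X.eps * (X.node ω a).cell.side))) := by
    by_cases hvw : v = w
    · subst hvw
      -- If both points share a subcell there is no clique edge, and none is needed.
      exact (Joined.refl _).mono (by positivity)
    refine (Joined.of_edge (by simpa using hvw)
      (.clique a v w (isSubcell_of_mem ha hv) (isSubcell_of_mem ha hw) hvw)).mono ?_
    have key : ∀ {l u}, X.pt l ∈ (X.region ω a u).region →
        dist (X.pt l) (X.region ω a u).center ≤ d * (X.eps * (X.node ω a).cell.side) := by
      intro l u hl
      rw [← region_side X ω a u]
      refine Cell.dist_le (Cell.region_subset_closedRegion _ hl)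
        (Cell.center_mem_closedRegion ?_)
      rw [region_side]
      positivity
    have h1 := key hv
    have h2 := key hw
    have h3 := dist_triangle4 (X.region ω a v).center (X.pt i) (X.pt j) (X.region ω a w).center
    rw [dist_comm _ (X.pt i)] at h3
    simp only [pos]
    linarith
  refine (((hX.joined_net hω he ha hi hv).trans hmid).trans
    (hX.joined_net hω he ha hj hw).symm).mono ?_ |>.graphDist_le
  linarith

omit hω in
-- Both points avoid the moats of the two halves along a separating coordinate. Each moat has width
-- half of Δ/n^4, so the points differ there by at least Δ/n^4.
theorem side_le_of_splits {i j : Fin n} {a : Address d} (h : X.Splits ω i j a) :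
    (X.node ω a).cell.side ≤ (n : ℝ) ^ 4 * dist (X.pt i) (X.pt j) := by
  obtain ⟨ha, hi, hj, hs, v, w, hvw, hv, hw⟩ := h
  obtain ⟨l, hl⟩ := Function.ne_iff.1 hvw
  have hij : i ≠ j := by
    rintro rfl
    exact hvw (Cell.part_unique hv hw)
  have hc : 1 < (X.node ω a).pts.card := Finset.one_lt_card.2 ⟨i, hi, j, hj, hij⟩
  have hn := hX.cast_pos
  have key : ∀ {m u}, m ∈ (X.node ω a).pts → X.pt m ∈ ((X.node ω a).cell.part 2 u).region →
      ((X.node ω a).cell.part 2 u).Within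
        (((X.node ω a).cell.part 2 u).side / (n : ℝ) ^ 4) (X.pt m) := by
    intro m u hm hu
    exact (he (some u :: a) ⟨ha, hc, hs, ⟨m, mem_pts_some.2 ⟨hm, hu⟩⟩⟩ m hu).1
  have h1 := key hi hv l
  have h2 := key hj hw l
  have h3 := Cell.abs_sub_le_dist (X.pt i) (X.pt j) l
  have h4 := hX.side_pos ha
  simp only [Cell.part_side, Cell.part_corner] at h1 h2
  set σ := (X.node ω a).cell.side with hσ
  have e1 : σ / (2 : ℕ) / (n : ℝ) ^ 4 = (σ / (n : ℝ) ^ 4) / 2 := by push_cast; ring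
  rw [e1] at h1 h2
  push_cast at h1 h2
  have key2 : σ / (n : ℝ) ^ 4 ≤ |X.pt i l - X.pt j l| := by
    rcases Nat.lt_or_gt_of_ne (fun h => hl (Fin.ext h)) with hlt | hlt
    · have : ((v l : ℕ) : ℝ) + 1 ≤ (w l : ℕ) := by exact_mod_cast hlt
      rw [abs_sub_comm]
      refine le_trans ?_ (le_abs_self _)
      nlinarith
    · have : ((w l : ℕ) : ℝ) + 1 ≤ (v l : ℕ) := by exact_mod_cast hlt
      refine le_trans ?_ (le_abs_self _)
      nlinarith
  have := key2.trans h3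
  rw [div_le_iff₀ (by positivity)] at this
  linarith

end Regular

end Config


/-! ### Density estimates for shifts on dyadic cubes -/

/-- The uniform measure on `[0,1)^d`. -/
def unitMeasure (d : ℕ) : Measure (Fin d → ℝ) :=
  Measure.pi fun _ => (volume : Measure ℝ).restrict (Set.Ico 0 1)

instance : IsProbabilityMeasure ((volume : Measure ℝ).restrict (Set.Ico 0 1)) :=
  ⟨by simp⟩

instance (d : ℕ) : IsProbabilityMeasure (unitMeasure d) := by
  unfold unitMeasure; infer_instance

theorem shiftMeasure_eq (n d : ℕ) :
    shiftMeasure n d = Measure.pi fun _ : Finset (Fin n) => unitMeasure d := rfl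

instance (n d : ℕ) : IsProbabilityMeasure (shiftMeasure n d) := by
  rw [shiftMeasure_eq]; infer_instance

theorem ae_mem_Ico_unitMeasure (d : ℕ) : ∀ᵐ u ∂unitMeasure d, ∀ j, u j ∈ Set.Ico (0 : ℝ) 1 := by
  unfold unitMeasure
  rw [ae_all_iff]
  intro j
  refine (Measure.tendsto_eval_ae_ae
    (μ := fun _ : Fin d => (volume : Measure ℝ).restrict (Set.Ico 0 1)) (i := j)).eventually ?_
  exact ae_restrict_mem measurableSet_Ico

theorem ae_mem_unitShifts (n d : ℕ) : ∀ᵐ ω ∂shiftMeasure n d, ω ∈ Config.unitShifts n d := by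
  rw [shiftMeasure_eq]
  have : ∀ᵐ ω ∂(Measure.pi fun _ : Finset (Fin n) => unitMeasure d),
      ∀ S, ∀ j, ω S j ∈ Set.Ico (0 : ℝ) 1 := by
    rw [ae_all_iff]
    intro S
    exact (Measure.tendsto_eval_ae_ae
      (μ := fun _ : Finset (Fin n) => unitMeasure d) (i := S)).eventually
      (ae_mem_Ico_unitMeasure d)
  exact this

theorem measurableSet_unitShifts (n d : ℕ) : MeasurableSet (Config.unitShifts n d) := by
  have : Config.unitShifts n d = ⋂ S, ⋂ j, (fun ω : Shifts n d => ω S j) ⁻¹' Set.Ico 0 1 := by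
    ext ω; simp [Config.unitShifts]
  rw [this]
  exact MeasurableSet.iInter fun S => MeasurableSet.iInter fun j =>
    (by fun_prop : Measurable fun ω : Shifts n d => ω S j) measurableSet_Ico

/-- The dyadic subinterval of `[0,1)` of length `2 ^ (-J)` with index `m`. -/
def dyadic (J m : ℕ) : Set ℝ := Set.Ico (m / 2 ^ J) ((m + 1) / 2 ^ J)

theorem exists_mem_dyadic {x : ℝ} (hx : x ∈ Set.Ico (0 : ℝ) 1) (J : ℕ) :
    ∃ m : Fin (2 ^ J), x ∈ dyadic J m := by
  have h2 : (0 : ℝ) < 2 ^ J := by positivity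
  refine ⟨⟨⌊x * 2 ^ J⌋₊, ?_⟩, ?_, ?_⟩
  · rw [Nat.floor_lt (mul_nonneg hx.1 h2.le)]
    push_cast
    nlinarith [hx.2]
  · rw [div_le_iff₀ h2]
    exact Nat.floor_le (mul_nonneg hx.1 h2.le)
  · rw [lt_div_iff₀ h2]
    exact Nat.lt_floor_add_one _

theorem dyadic_subset (J : ℕ) (m : Fin (2 ^ J)) : dyadic J m ⊆ Set.Ico 0 1 := by
  intro x hx
  have h2 : (0 : ℝ) < 2 ^ J := by positivity
  have hm : ((m : ℕ) : ℝ) + 1 ≤ 2 ^ J := by exact_mod_cast m.2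
  refine ⟨le_trans (by positivity) hx.1, hx.2.trans_le ?_⟩
  rw [div_le_one h2]
  exact hm

theorem abs_sub_lt_of_mem_dyadic {J m : ℕ} {x y : ℝ} (hx : x ∈ dyadic J m) (hy : y ∈ dyadic J m) :
    |x - y| < 1 / 2 ^ J := by
  have h1 := hx.1
  have h2 := hx.2
  have h3 := hy.1
  have h4 := hy.2
  rw [add_div] at h2 h4
  rw [abs_lt]
  constructor <;> linarith

theorem volume_dyadic (J m : ℕ) : volume (dyadic J m) = ENNReal.ofReal (1 / 2 ^ J) := by
  unfold dyadic
  rw [Real.volume_Ico]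
  congr 1
  ring

theorem measurableSet_dyadic (J m : ℕ) : MeasurableSet (dyadic J m) := measurableSet_Ico

/-- A product measure: only the factor of coordinate `i` changes. -/
theorem unitMeasure_dyadicCube_inter_le {d : ℕ} (J : ℕ) (κ : Fin d → Fin (2 ^ J)) {B : Set ℝ}
    (i : Fin d) {c : ℝ≥0∞}
    (hc : volume (B ∩ dyadic J (κ i)) ≤ c * volume (dyadic J (κ i))) :
    unitMeasure d ((Set.univ.pi fun i => dyadic J (κ i)) ∩ {u | u i ∈ B}) ≤
      c * unitMeasure d (Set.univ.pi fun i => dyadic J (κ i)) := by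
  classical
  have hsub : ((Set.univ.pi fun i => dyadic J (κ i)) ∩ {u | u i ∈ B}) ⊆
      Set.univ.pi (Function.update (fun i => dyadic J (κ i)) i (B ∩ dyadic J (κ i))) := by
    rintro u ⟨hu, hB⟩ l -
    by_cases hl : l = i
    · subst hl
      simpa using ⟨hB, hu l trivial⟩
    · simpa [hl] using hu l trivial
  refine (measure_mono hsub).trans ?_
  unfold unitMeasure
  rw [Measure.pi_pi, Measure.pi_pi, ← Finset.mul_prod_erase _ _ (Finset.mem_univ i),
    ← Finset.mul_prod_erase _ _ (Finset.mem_univ i), ← mul_assoc]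
  gcongr ?_ * ?_
  · rw [Function.update_self, Measure.restrict_apply (measurableSet_dyadic _ _),
      Set.inter_eq_left.2 (dyadic_subset _ _)]
    exact (Measure.restrict_apply_le _ _).trans hc
  · apply le_of_eq
    apply Finset.prod_congr rfl
    intro l hl
    rw [Function.update_of_ne (Finset.ne_of_mem_erase hl)]

/-- If `T` contains all dyadic cubes that meet `R`, and the sets `B i` have density at most `c` in
each dyadic interval, then the part of `R` with a coordinate in its `B i` is small relative
to `T`. -/
theorem unitMeasure_inter_le {d : ℕ} (J : ℕ) {R T : Set (Fin d → ℝ)}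
    {B : Fin d → Set ℝ} {c : ℝ≥0∞}
    (hB : ∀ i, ∀ m : Fin (2 ^ J), volume (B i ∩ dyadic J m) ≤ c * volume (dyadic J m))
    (hRT : ∀ u ∈ R, ∀ u', (∀ i, u i ∈ Set.Ico (0 : ℝ) 1) → (∀ i, u' i ∈ Set.Ico (0 : ℝ) 1) →
      (∀ i, |u' i - u i| < 1 / 2 ^ J) → u' ∈ T) :
    unitMeasure d (R ∩ {u | ∃ i, u i ∈ B i}) ≤ d * c * unitMeasure d T := by
  classical
  set Q : (Fin d → Fin (2 ^ J)) → Set (Fin d → ℝ) :=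
    fun κ => Set.univ.pi fun i => dyadic J (κ i) with hQ
  have hQm : ∀ κ, MeasurableSet (Q κ) := fun κ =>
    MeasurableSet.univ_pi fun i => measurableSet_dyadic _ _
  have hQd : Pairwise (Function.onFun Disjoint Q) := by
    intro κ κ' hne
    rw [Function.onFun, Set.disjoint_left]
    intro u hu hu'
    apply hne
    funext i
    have h1 := hu i trivial
    have h2 := hu' i trivial
    have hp : (0 : ℝ) < 2 ^ J := by positivity
    have a1 := (div_le_iff₀ hp).1 h1.1
    have a2 := (lt_div_iff₀ hp).1 h1.2
    have a3 := (div_le_iff₀ hp).1 h2.1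
    have a4 := (lt_div_iff₀ hp).1 h2.2
    have b1 : (κ i : ℕ) < (κ' i : ℕ) + 1 := by exact_mod_cast a1.trans_lt a4
    have b2 : (κ' i : ℕ) < (κ i : ℕ) + 1 := by exact_mod_cast a3.trans_lt a2
    exact Fin.ext (by omega)
  -- The finitely many cubes that meet `R` cover it up to a null set, and by hypothesis they lie in
  -- `T`, so their total mass is at most that of `T`.
  set G : Finset (Fin d → Fin (2 ^ J)) := Finset.univ.filter fun κ => (Q κ ∩ R).Nonempty
    with hG
  have hcover : ∀ᵐ u ∂unitMeasure d, u ∈ R ∩ {u | ∃ i, u i ∈ B i} →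
      u ∈ ⋃ κ ∈ G, ⋃ i, Q κ ∩ {u | u i ∈ B i} := by
    filter_upwards [ae_mem_Ico_unitMeasure d] with u hu ⟨hR, i, hi⟩
    choose κ hκ using fun i => exists_mem_dyadic (hu i) J
    simp only [Set.mem_iUnion]
    exact ⟨κ, Finset.mem_filter.2 ⟨Finset.mem_univ _, u, fun i _ => hκ i, hR⟩, i,
      fun i _ => hκ i, hi⟩
  have hGT : ∀ κ ∈ G, Q κ ⊆ T := by
    intro κ hκ u' hu'
    obtain ⟨u, hu, hR⟩ := (Finset.mem_filter.1 hκ).2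
    exact hRT u hR u' (fun i => dyadic_subset _ _ (hu i trivial))
      (fun i => dyadic_subset _ _ (hu' i trivial))
      (fun i => abs_sub_lt_of_mem_dyadic (hu' i trivial) (hu i trivial))
  calc unitMeasure d (R ∩ {u | ∃ i, u i ∈ B i})
      ≤ unitMeasure d (⋃ κ ∈ G, ⋃ i, Q κ ∩ {u | u i ∈ B i}) := measure_mono_ae hcover
    _ ≤ ∑ κ ∈ G, unitMeasure d (⋃ i, Q κ ∩ {u | u i ∈ B i}) := measure_biUnion_finset_le _ _
    _ ≤ ∑ κ ∈ G, ∑ i, unitMeasure d (Q κ ∩ {u | u i ∈ B i}) := by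
        gcongr
        exact measure_iUnion_fintype_le _ _
    _ ≤ ∑ κ ∈ G, ∑ _i : Fin d, c * unitMeasure d (Q κ) := by
        gcongr with κ _ i _
        exact unitMeasure_dyadicCube_inter_le J κ i (hB i (κ i))
    _ = d * c * ∑ κ ∈ G, unitMeasure d (Q κ) := by
        simp only [Finset.sum_const, Finset.card_univ, Fintype.card_fin, nsmul_eq_mul,
          Finset.mul_sum, mul_assoc]
    _ ≤ d * c * unitMeasure d T := by
        gcongr
        rw [← measure_biUnion_finset (fun κ _ κ' _ h => hQd h) fun κ _ => hQm κ]
        exact measure_mono (Set.iUnion₂_subset hGT)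

/-- The version of `unitMeasure_inter_le` for one of the independent shift vectors. -/
theorem shiftMeasure_inter_le {n d : ℕ} (S : Finset (Fin n)) (J : ℕ) {R T : Set (Shifts n d)}
    (hR : MeasurableSet R) (hT : MeasurableSet T) {B : Fin d → Set ℝ}
    (hBm : ∀ i, MeasurableSet (B i)) {c : ℝ≥0∞}
    (hB : ∀ i, ∀ m : Fin (2 ^ J), volume (B i ∩ dyadic J m) ≤ c * volume (dyadic J m))
    (hRT : ∀ ω ∈ R, ∀ u : Fin d → ℝ, (∀ i, u i ∈ Set.Ico (0 : ℝ) 1) →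
      (∀ i, |u i - ω S i| < 1 / 2 ^ J) → Function.update ω S u ∈ T) :
    shiftMeasure n d (R ∩ {ω | ∃ i, ω S i ∈ B i}) ≤ d * c * shiftMeasure n d T := by
  have hBad : MeasurableSet {ω : Shifts n d | ∃ i, ω S i ∈ B i} := by
    have : {ω : Shifts n d | ∃ i, ω S i ∈ B i} = ⋃ i, (fun ω : Shifts n d => ω S i) ⁻¹' B i := by
      ext; simp
    rw [this]
    exact MeasurableSet.iUnion fun i =>
      (by fun_prop : Measurable fun ω : Shifts n d => ω S i) (hBm i)
  have hRB := hR.inter hBad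
  rw [← lintegral_indicator_one hRB, ← lintegral_indicator_one hT, ← lintegral_const_mul]
  swap
  · exact measurable_one.indicator hT
  rw [shiftMeasure_eq]
  -- By Fubini, freeze all shift vectors except that of `S`.
  refine lintegral_le_of_lmarginal_le {S} (measurable_one.indicator hRB)
    ((measurable_one.indicator hT).const_mul _) ?_
  intro ω
  rw [lmarginal_singleton, lmarginal_singleton]
  have hupd : Measurable fun u : Fin d → ℝ => Function.update ω S u := measurable_update ω
  beta_reduce
  rw [lintegral_const_mul (d * c) (f := fun u => T.indicator 1 (Function.update ω S u))
    ((measurable_one.indicator hT).comp hupd)]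
  have e : ∀ A : Set (Shifts n d), MeasurableSet A →
      ∫⁻ u, A.indicator (1 : Shifts n d → ℝ≥0∞) (Function.update ω S u) ∂unitMeasure d =
        unitMeasure d ((fun u => Function.update ω S u) ⁻¹' A) := by
    intro A hA
    rw [← lintegral_indicator_one (hupd hA)]
    rfl
  rw [e _ hRB, e _ hT]
  have := unitMeasure_inter_le (R := (fun u => Function.update ω S u) ⁻¹' R)
    (T := (fun u => Function.update ω S u) ⁻¹' T) J hB ?_
  · convert this using 2
    ext u
    simp
  · intro u hu u' _ hu' hd
    have := hRT _ hu u' hu' (by simpa using hd)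
    simpa using this

/-- A union of translates of an interval along an arithmetic progression. -/
def progression (y τ β : ℝ) : Set ℝ := ⋃ c : ℤ, Set.Icc (y + c * τ) (y + c * τ + β)

theorem measurableSet_progression (y τ β : ℝ) : MeasurableSet (progression y τ β) :=
  MeasurableSet.iUnion fun _ => measurableSet_Icc

/-- An interval shorter than the spacing meets at most two translates if these are shorter than it
too. If they are at least as long as the interval, the bound is trivial. -/
theorem volume_progression_inter_dyadic_le (y : ℝ) {τ β : ℝ} (J m : ℕ) (hτ : 1 / 2 ^ J ≤ τ)
    (hβ : 0 ≤ β) :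
    volume (progression y τ β ∩ dyadic J m) ≤
      ENNReal.ofReal (2 * β * 2 ^ J) * volume (dyadic J m) := by
  have h2 : (0 : ℝ) < 2 ^ J := by positivity
  have hτ0 : 0 < τ := lt_of_lt_of_le (by positivity) hτ
  rw [volume_dyadic, ← ENNReal.ofReal_mul (by positivity)]
  have e : 2 * β * 2 ^ J * (1 / 2 ^ J) = β + β := by field_simp; ring
  rw [e]
  by_cases hβτ : 1 / 2 ^ J ≤ β
  · refine (measure_mono Set.inter_subset_right).trans ?_
    rw [volume_dyadic]
    exact ENNReal.ofReal_le_ofReal (by linarith)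
  push Not at hβτ
  obtain ⟨a, ha⟩ : ∃ a : ℝ, a = m / 2 ^ J := ⟨_, rfl⟩
  have hsub : progression y τ β ∩ dyadic J m ⊆
      Set.Icc (y + ⌈(a - β - y) / τ⌉ * τ) (y + ⌈(a - β - y) / τ⌉ * τ + β) ∪
      Set.Icc (y + (⌈(a - β - y) / τ⌉ + 1) * τ) (y + (⌈(a - β - y) / τ⌉ + 1) * τ + β) := by
    rintro x ⟨hx, hx1, hx2⟩
    obtain ⟨c, hc1, hc2⟩ := Set.mem_iUnion.1 hx
    rw [add_div, ← ha] at hx2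
    rw [← ha] at hx1
    have l1 : ⌈(a - β - y) / τ⌉ ≤ c := by
      rw [Int.ceil_le, div_le_iff₀ hτ0]
      linarith
    have l2 : c < ⌈(a - β - y) / τ⌉ + 2 := by
      have := (div_le_iff₀ hτ0).1 (Int.le_ceil ((a - β - y) / τ))
      have h : (c : ℝ) * τ < (⌈(a - β - y) / τ⌉ + 2) * τ := by linarith
      have := lt_of_mul_lt_mul_right h hτ0.le
      exact_mod_cast this
    rcases (by omega : c = ⌈(a - β - y) / τ⌉ ∨ c = ⌈(a - β - y) / τ⌉ + 1) with h | h
    · left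
      rw [← h]
      exact ⟨hc1, hc2⟩
    · right
      have : (⌈(a - β - y) / τ⌉ : ℝ) + 1 = c := by rw [h]; push_cast; rfl
      rw [this]
      exact ⟨hc1, hc2⟩
  refine (measure_mono hsub).trans ((measure_union_le _ _).trans ?_)
  rw [Real.volume_Icc, Real.volume_Icc, ENNReal.ofReal_add hβ hβ]
  simp


/-! ### Measurability of the construction -/

/-- Compression makes a cell depend on a random set of points; that set has finitely many values, so
it suffices to treat each value separately. -/
theorem measurable_of_fibers {Ω ι β : Type*} [MeasurableSpace Ω] [MeasurableSpace β] [Countable ι]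
    {f : Ω → ι} (hf : ∀ Q, MeasurableSet {ω | f ω = Q}) {g : ι → Ω → β}
    (hg : ∀ Q, Measurable (g Q)) : Measurable fun ω => g (f ω) ω := by
  intro s hs
  have : (fun ω => g (f ω) ω) ⁻¹' s = ⋃ Q, {ω | f ω = Q} ∩ g Q ⁻¹' s := by
    ext ω
    simp
  rw [this]
  exact MeasurableSet.iUnion fun Q => (hf Q).inter (hg Q hs)

namespace Cell

variable {d : ℕ} {Ω : Type*} [MeasurableSpace Ω]

/-- A random cell whose corner and side are measurable. -/
structure IsMeasurable (C : Ω → Cell d) : Prop where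
  corner : ∀ j, Measurable fun ω => (C ω).corner j
  side : Measurable fun ω => (C ω).side

namespace IsMeasurable

variable {C : Ω → Cell d} (hC : IsMeasurable C)
include hC

theorem part (m : ℕ) (v : Fin d → Fin m) : IsMeasurable fun ω => (C ω).part m v where
  corner j := by
    have h1 := hC.corner j
    have h2 := hC.side
    simp only [part_corner]
    fun_prop
  side := by
    have h2 := hC.side
    simp only [part_side]
    fun_prop

theorem mem_region (x : Pt d) : Measurable fun ω => x ∈ (C ω).region := by
  refine Measurable.forall fun j => ?_
  have h1 := hC.corner j
  have h2 := hC.side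
  exact Measurable.and (measurableSet_setOfPred.1 (measurableSet_le h1 measurable_const))
    (measurableSet_setOfPred.1 (measurableSet_lt measurable_const (h1.add h2)))

theorem within {h : Ω → ℝ} (hh : Measurable h) (x : Pt d) :
    Measurable fun ω => (C ω).Within (h ω) x := by
  refine Measurable.forall fun j => ?_
  have h1 := hC.corner j
  have h2 := hC.side
  exact Measurable.and (measurableSet_setOfPred.1 (measurableSet_le (h1.add hh) measurable_const))
    (measurableSet_setOfPred.1 (measurableSet_le measurable_const ((h1.add h2).sub hh)))

theorem center (j : Fin d) : Measurable fun ω => (C ω).center j := by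
  have h1 := hC.corner j
  have h2 := hC.side
  simp only [Cell.center]
  fun_prop

end IsMeasurable

/-- Expresses the parent-edge condition by inequalities between corners and sides, which are visibly
measurable. Empty cubes have to be listed apart. -/
theorem region_subset_region_iff (C D : Cell d) : C.region ⊆ D.region ↔
    (C.side ≤ 0 ∧ 0 < d) ∨
      ∀ j, D.corner j ≤ C.corner j ∧ C.corner j + C.side ≤ D.corner j + D.side := by
  constructor
  · intro h
    by_cases hd : 0 < d
    swap
    · exact Or.inr fun j => absurd (j.pos) hd
    by_cases hs : C.side ≤ 0
    · exact Or.inl ⟨hs, hd⟩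
    push Not at hs
    right
    intro j
    have h0 : WithLp.toLp 2 C.corner ∈ C.region := fun i => ⟨le_rfl, by simpa using hs⟩
    refine ⟨(h h0 j).1, ?_⟩
    by_contra! hlt
    have h1 : WithLp.toLp 2
        (Function.update C.corner j (max (C.corner j) (D.corner j + D.side))) ∈ C.region := by
      intro i
      by_cases hi : i = j
      · subst hi
        simpa using ⟨hs, hlt⟩
      · simpa [hi] using hs
    have h2 := (h h1 j).2
    simp at h2
  · rintro (⟨hs, hd⟩ | h) x hx
    · have := hx ⟨0, hd⟩
      linarith
    · intro j
      have h1 := h j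
      have h2 := hx j
      constructor <;> linarith

theorem IsMeasurable.region_subset {C D : Ω → Cell d} (hC : IsMeasurable C)
    (hD : IsMeasurable D) : Measurable fun ω => (C ω).region ⊆ (D ω).region := by
  simp only [region_subset_region_iff]
  refine Measurable.or (Measurable.and (measurableSet_setOfPred.1
    (measurableSet_le hC.side measurable_const)) measurable_const) (Measurable.forall fun j => ?_)
  exact Measurable.and (measurableSet_setOfPred.1 (measurableSet_le (hD.corner j) (hC.corner j)))
    (measurableSet_setOfPred.1
      (measurableSet_le ((hC.corner j).add hC.side) ((hD.corner j).add hD.side)))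

end Cell

/-- Makes quantifiers and infima over vertices, and over finite lists of them, countable operations.
-/
instance (n d k : ℕ) : Countable (Vertex n d k) := by
  let g : Vertex n d k → Fin n ⊕ (Address d × (Fin d → Fin (2 ^ k))) := fun
    | .point i => .inl i
    | .net a v => .inr (a, v)
  refine Function.Injective.countable (f := g) ?_
  rintro (i | ⟨a, v⟩) (j | ⟨b, w⟩) h <;> simp_all [g]

namespace Config

variable {n d : ℕ} (X : Config n d)

theorem measurable_node (a : Address d) :
    Cell.IsMeasurable (fun ω => (X.node ω a).cell) ∧
      ∀ Q, MeasurableSet {ω | (X.node ω a).pts = Q} := by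
  have triple : ∀ S, Cell.IsMeasurable fun ω : Shifts n d => (X.box S).tripleShift (ω S) := by
    intro S
    refine ⟨fun j => ?_, ?_⟩
    · simp only [Cell.tripleShift_corner]
      fun_prop
    · simp only [Cell.tripleShift_side]
      fun_prop
  induction a with
  | nil => exact ⟨triple _, fun Q => MeasurableSet.const (Finset.univ = Q)⟩
  | cons s a ih =>
    cases s with
    | none =>
      refine ⟨⟨fun j => ?_, ?_⟩, ih.2⟩
      · exact measurable_of_fibers ih.2 (g := fun S ω => ((X.box S).tripleShift (ω S)).corner j)
          fun Q => (triple Q).corner j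
      · exact measurable_of_fibers ih.2 (g := fun S ω => ((X.box S).tripleShift (ω S)).side)
          fun Q => (triple Q).side
    | some v =>
      have hC := ih.1.part 2 v
      refine ⟨hC, fun Q => ?_⟩
      have : {ω | (X.node ω (some v :: a)).pts = Q} = {ω | ∀ i, i ∈ Q ↔
          (i ∈ (X.node ω a).pts ∧ X.pt i ∈ ((X.node ω a).cell.part 2 v).region)} := by
        ext ω
        simp only [Set.mem_ofPred_eq, Finset.ext_iff, mem_pts_some]
        exact forall_congr' fun i => iff_comm
      rw [this, measurableSet_setOfPred]
      refine Measurable.forall fun i => Measurable.iff measurable_const (Measurable.and ?_ ?_)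
      · exact measurable_of_fibers ih.2 (g := fun S _ => i ∈ S) fun _ => measurable_const
      · exact hC.mem_region _

theorem measurable_cell (a : Address d) : Cell.IsMeasurable fun ω => (X.node ω a).cell :=
  (X.measurable_node a).1

theorem measurable_of_pts {β : Type*} [MeasurableSpace β] (a : Address d)
    (g : Finset (Fin n) → β) : Measurable fun ω => g (X.node ω a).pts :=
  measurable_of_fibers (X.measurable_node a).2 (g := fun S _ => g S) fun _ => measurable_const

theorem measurable_mem_pts (a : Address d) (i : Fin n) :
    Measurable fun ω => i ∈ (X.node ω a).pts :=
  X.measurable_of_pts a (g := fun S => i ∈ S)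

theorem measurable_small (a : Address d) : Measurable fun ω => X.Small (X.node ω a) := by
  unfold Small
  have h1 := X.measurable_of_pts a (g := fun S => (X.box S).side)
  have h2 := (X.measurable_cell a).side
  exact measurableSet_setOfPred.1 (measurableSet_lt h1 (by fun_prop))

theorem measurable_isNode (a : Address d) : Measurable fun ω => X.IsNode ω a := by
  induction a with
  | nil => exact measurable_const
  | cons s a ih =>
    have hc := X.measurable_of_pts a (g := fun S => 1 < S.card)
    cases s with
    | none => exact ih.and (hc.and (X.measurable_small a))
    | some v =>
      exact ih.and (hc.and ((X.measurable_small a).not.and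
        (X.measurable_of_pts (some v :: a) (g := fun S => S.Nonempty))))

theorem measurable_rootSet_eq (a : Address d) (S : Finset (Fin n)) :
    Measurable fun ω => X.rootSet ω a = S := by
  induction a with
  | nil => exact measurable_const (a := Finset.univ = S)
  | cons s a ih =>
    cases s with
    | none => exact X.measurable_of_pts a (g := fun T => T = S)
    | some v => exact ih

theorem measurable_region (a : Address d) (v : Fin d → Fin (2 ^ X.k)) :
    Cell.IsMeasurable fun ω => X.region ω a v :=
  (X.measurable_cell a).part _ v

theorem measurableSet_avoidsMoats : MeasurableSet X.avoidsMoats := by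
  unfold avoidsMoats
  rw [measurableSet_setOfPred]
  refine Measurable.forall fun a => (X.measurable_isNode a).imp (Measurable.forall fun i =>
    ((X.measurable_cell a).mem_region _).imp (Measurable.and ?_ (Measurable.forall fun v =>
      ((X.measurable_region a v).mem_region _).imp ?_)))
  · exact (X.measurable_cell a).within ((X.measurable_cell a).side.div_const _) _
  · exact (X.measurable_region a v).within
      (((X.measurable_cell a).side.const_mul _).div_const _) _

theorem measurable_isSubcell (a : Address d) (v : Fin d → Fin (2 ^ X.k)) :
    Measurable fun ω => X.IsSubcell ω a v :=
  (X.measurable_isNode a).and (Measurable.exists fun _ =>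
    (X.measurable_region a v).mem_region _)

theorem edge_net_net_iff {ω : Shifts n d} {a b : Address d} {v w : Fin d → Fin (2 ^ X.k)} :
    X.Edge ω (.net a v) (.net b w) ↔
      (a = b ∧ v ≠ w ∧ X.IsSubcell ω a v ∧ X.IsSubcell ω b w) ∨
      ((∃ s, a = s :: b) ∧ X.IsSubcell ω a v ∧ X.IsSubcell ω b w ∧
        (X.region ω a v).region ⊆ (X.region ω b w).region) := by
  constructor
  · intro h
    cases h with
    | clique _ _ _ h1 h2 h3 => exact Or.inl ⟨rfl, h3, h1, h2⟩
    | parent s _ _ _ h1 h2 h3 => exact Or.inr ⟨⟨s, rfl⟩, h1, h2, h3⟩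
  · rintro (⟨rfl, h3, h1, h2⟩ | ⟨⟨s, rfl⟩, h1, h2, h3⟩)
    · exact .clique _ _ _ h1 h2 h3
    · exact .parent _ _ _ _ h1 h2 h3

theorem edge_point_net_iff {ω : Shifts n d} {i : Fin n} {a : Address d}
    {v : Fin d → Fin (2 ^ X.k)} :
    X.Edge ω (.point i) (.net a v) ↔
      X.IsSubcell ω a v ∧ X.pt i ∈ (X.region ω a v).region ∧
      (∀ b w, X.IsSubcell ω b w → X.pt i ∈ (X.region ω b w).region →
        (X.region ω a v).side ≤ (X.region ω b w).side) := by
  constructor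
  · intro h
    cases h with
    | point _ _ _ h1 h2 h3 => exact ⟨h1, h2, h3⟩
  · rintro ⟨h1, h2, h3⟩
    exact .point _ _ _ h1 h2 h3

theorem not_edge_point {ω : Shifts n d} {u : Vertex n d X.k} {i : Fin n} :
    ¬ X.Edge ω u (.point i) := by
  intro h
  cases h

theorem measurable_edge (u v : Vertex n d X.k) : Measurable fun ω => X.Edge ω u v := by
  cases v with
  | point j => simp only [not_edge_point, measurable_const]
  | net b w =>
    cases u with
    | point i =>
      simp only [edge_point_net_iff]
      refine (X.measurable_isSubcell _ _).and (((X.measurable_region _ _).mem_region _).and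
        (Measurable.forall fun c => Measurable.forall fun z => (X.measurable_isSubcell _ _).imp
          (((X.measurable_region _ _).mem_region _).imp ?_)))
      exact measurableSet_setOfPred.1
        (measurableSet_le (X.measurable_region _ _).side (X.measurable_region _ _).side)
    | net a v =>
      simp only [edge_net_net_iff]
      exact (measurable_const.and (measurable_const.and ((X.measurable_isSubcell _ _).and
        (X.measurable_isSubcell _ _)))).or (measurable_const.and ((X.measurable_isSubcell _ _).and
        ((X.measurable_isSubcell _ _).and
          ((X.measurable_region _ _).region_subset (X.measurable_region _ _)))))

theorem measurable_adj (u v : Vertex n d X.k) : Measurable fun ω => (X.graph ω).Adj u v := by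
  unfold graph
  simp only [SimpleGraph.fromRel_adj]
  exact measurable_const.and ((X.measurable_edge u v).or (X.measurable_edge v u))

theorem measurable_dist_pos (u v : Vertex n d X.k) :
    Measurable fun ω => dist (X.pos ω u) (X.pos ω v) := by
  have hpos : ∀ (w : Vertex n d X.k) (j : Fin d), Measurable fun ω => X.pos ω w j := by
    intro w j
    cases w with
    | point i => exact measurable_const (a := X.pt i j)
    | net a z => exact (X.measurable_region a z).center j
  simp only [EuclideanSpace.dist_eq]
  refine Measurable.sqrt (Finset.measurable_sum _ fun j _ => Measurable.pow_const ?_ 2)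
  exact (hpos u j).dist (hpos v j)

open Classical in
/-- The length of the walk that starts at `u`, visits the vertices of a list and ends in `v`;
`⊤` if there is no such walk. -/
def listLength (ω : Shifts n d) (v : Vertex n d X.k) :
    Vertex n d X.k → List (Vertex n d X.k) → ℝ≥0∞
  | u, [] => if u = v then 0 else ⊤
  | u, x :: l => if (X.graph ω).Adj u x then
      ENNReal.ofReal (dist (X.pos ω u) (X.pos ω x)) + listLength ω v x l else ⊤

theorem measurable_listLength (u v : Vertex n d X.k) (l : List (Vertex n d X.k)) :
    Measurable fun ω => X.listLength ω v u l := by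
  classical
  induction l generalizing u with
  | nil => exact measurable_const
  | cons x l ih =>
    exact Measurable.ite (measurableSet_setOfPred.2 (X.measurable_adj u x))
      ((X.measurable_dist_pos u x).ennreal_ofReal.add (ih x)) measurable_const

theorem exists_listLength_eq (ω : Shifts n d) {u v : Vertex n d X.k}
    (w : (X.graph ω).Walk u v) :
    ∃ l, X.listLength ω v u l = ENNReal.ofReal (X.walkLength ω w) := by
  induction w with
  | nil => exact ⟨[], by simp [listLength, walkLength]⟩
  | @cons u x v h p ih =>
    obtain ⟨l, hl⟩ := ih
    refine ⟨x :: l, ?_⟩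
    have hp : 0 ≤ X.walkLength ω p := by
      unfold walkLength
      refine List.sum_nonneg fun y hy => ?_
      obtain ⟨e, -, rfl⟩ := List.mem_map.1 hy
      exact dist_nonneg
    have : X.walkLength ω (.cons h p) =
        dist (X.pos ω u) (X.pos ω x) + X.walkLength ω p := by
      simp [walkLength]
    rw [this, ENNReal.ofReal_add dist_nonneg hp, ← hl, listLength, if_pos h]

theorem graphDist_le_listLength (ω : Shifts n d) (u v : Vertex n d X.k)
    (l : List (Vertex n d X.k)) : X.graphDist ω u v ≤ X.listLength ω v u l := by
  induction l generalizing u with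
  | nil =>
    rw [listLength]
    split_ifs with h
    · subst h
      exact (iInf_le _ .nil).trans (by simp [walkLength])
    · exact le_top
  | cons x l ih =>
    rw [listLength]
    split_ifs with h
    · refine le_trans ?_ (add_le_add_right (ih x) _)
      unfold graphDist
      rw [ENNReal.add_iInf]
      refine le_iInf fun p => (iInf_le _ (.cons h p)).trans ?_
      have : X.walkLength ω (.cons h p) =
          dist (X.pos ω u) (X.pos ω x) + X.walkLength ω p := by
        simp [walkLength]
      rw [this]
      exact ENNReal.ofReal_add_le
    · exact le_top

/-- The type of walks depends on the shifts. Lists of vertices do not and are countable, so the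
distance becomes an infimum over a fixed countable family. -/
theorem measurable_graphDist (u v : Vertex n d X.k) :
    Measurable fun ω => X.graphDist ω u v := by
  have : (fun ω => X.graphDist ω u v) = fun ω => ⨅ l, X.listLength ω v u l := by
    funext ω
    apply le_antisymm
    · exact le_iInf fun l => X.graphDist_le_listLength ω u v l
    · refine le_iInf fun w => ?_
      obtain ⟨l, hl⟩ := X.exists_listLength_eq ω w
      rw [← hl]
      exact iInf_le _ l
  rw [this]
  exact Measurable.iInf fun l => X.measurable_listLength u v l

end Config


/-! ### Dependence of the quadtree on a single shift -/

namespace Config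

variable {n d : ℕ} {X : Config n d} {ω : Shifts n d}

/-- The quadtree over `S` is built and divided `lev` times along the path to the point `i`. -/
def inTree (X : Config n d) (S : Finset (Fin n)) (lev : ℕ) (i : Fin n) : Set (Shifts n d) :=
  {ω | ∃ a, X.IsNode ω a ∧ X.rootSet ω a = S ∧ level a = lev ∧ i ∈ (X.node ω a).pts}

theorem measurableSet_inTree (X : Config n d) (S : Finset (Fin n)) (lev : ℕ) (i : Fin n) :
    MeasurableSet (X.inTree S lev i) := by
  unfold inTree
  rw [measurableSet_setOfPred]
  exact Measurable.exists fun a => (X.measurable_isNode a).and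
    ((X.measurable_rootSet_eq a S).and (measurable_const.and (X.measurable_mem_pts a i)))

theorem rootSet_cons_subset (s : Option (Fin d → Fin 2)) (a : Address d) :
    X.rootSet ω (s :: a) ⊆ X.rootSet ω a := by
  cases s with
  | none => exact pts_subset_rootSet a
  | some v => exact subset_rfl

theorem rootSet_subset_of_suffix {a b : Address d} (h : a <:+ b) :
    X.rootSet ω b ⊆ X.rootSet ω a := by
  induction b with
  | nil => rw [List.suffix_nil.1 h]
  | cons s b ih =>
    rcases List.suffix_cons_iff.1 h with rfl | h
    · rfl
    · exact (rootSet_cons_subset s b).trans (ih h)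

theorem exists_suffix_level {a : Address d} {m : ℕ} (h : m ≤ level a) :
    ∃ b, b <:+ a ∧ level b = m ∧ X.rootSet ω b = X.rootSet ω a := by
  induction a with
  | nil => exact ⟨[], List.suffix_rfl, by simp_all [level], rfl⟩
  | cons s a ih =>
    cases s with
    | none => exact ⟨none :: a, List.suffix_rfl, by simp_all [level], rfl⟩
    | some v =>
      rcases Nat.lt_or_eq_of_le h with h | h
      · obtain ⟨b, hb, h1, h2⟩ := ih (Nat.lt_succ_iff.1 h)
        exact ⟨b, hb.trans (List.suffix_cons _ _), h1, h2⟩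
      · exact ⟨some v :: a, List.suffix_rfl, h.symm, rfl⟩

theorem IsNode.mem_inTree {a : Address d} (ha : X.IsNode ω a) {i : Fin n}
    (hi : i ∈ (X.node ω a).pts) {m : ℕ} (h : m ≤ level a) :
    ω ∈ X.inTree (X.rootSet ω a) m i := by
  obtain ⟨b, hb, h1, h2⟩ := exists_suffix_level (X := X) (ω := ω) h
  exact ⟨b, ha.of_suffix hb, h2, h1, pts_subset_of_suffix hb hi⟩

/-- The nodes outside the quadtree over `S` do not depend on the shift of that quadtree. -/
theorem node_congr {ω' : Shifts n d} {S : Finset (Fin n)} (hS : ∀ T, T ≠ S → ω' T = ω T)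
    {a : Address d} (ha : X.IsNode ω a) (hSa : S ⊆ (X.node ω a).pts) (hne : X.rootSet ω a ≠ S) :
    X.node ω' a = X.node ω a ∧ X.IsNode ω' a ∧ X.rootSet ω' a = X.rootSet ω a := by
  induction a with
  | nil =>
    refine ⟨?_, trivial, rfl⟩
    simp only [node]
    rw [hS Finset.univ hne]
  | cons s a ih =>
    have hSa' := hSa.trans (pts_cons_subset s a)
    -- Root sets shrink downwards; a parent in the quadtree over `S` would squeeze the child's root
    -- set to `S`.
    have hne' : X.rootSet ω a ≠ S := by
      rintro rfl
      exact hne ((rootSet_cons_subset s a).antisymm (hSa.trans (pts_subset_rootSet _)))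
    obtain ⟨h1, h2, h3⟩ := ih ha.tail hSa' hne'
    cases s with
    | none =>
      have h4 : X.node ω' (none :: a) = X.node ω (none :: a) := by
        simp only [node, h1]
        rw [hS (X.node ω a).pts hne]
      refine ⟨h4, ⟨h2, ?_⟩, by simp only [rootSet, h1]⟩
      rw [h1]
      exact ha.2
    | some v =>
      have h4 : X.node ω' (some v :: a) = X.node ω (some v :: a) := by
        simp only [node]
        rw [h1]
      refine ⟨h4, ⟨h2, ?_⟩, h3⟩
      rw [h4, h1]
      exact ha.2

namespace Regular

variable (hX : X.Regular)
include hX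

/-- Whether the quadtree over `S` is built does not depend on its shift. -/
theorem root_congr {ω' : Shifts n d} {S : Finset (Fin n)} (hS : ∀ T, T ≠ S → ω' T = ω T)
    {a : Address d} (ha : X.IsNode ω a) (hSa : X.rootSet ω a = S) (hl : level a = 0) :
    X.IsNode ω' a ∧ X.rootSet ω' a = S ∧ (X.node ω' a).pts = (X.node ω a).pts ∧
      ∀ l, (X.node ω' a).cell.corner l =
        (X.node ω a).cell.corner l + (ω' S l - ω S l) * (X.box S).side := by
  cases a with
  | nil =>
    refine ⟨trivial, hSa, rfl, fun l => ?_⟩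
    obtain rfl : Finset.univ = S := hSa
    simp only [node, Cell.tripleShift_corner]
    ring
  | cons s a =>
    cases s with
    | some v => simp [level] at hl
    | none =>
      have hSa' : (X.node ω a).pts = S := hSa
      -- A compressed node has lost points of its own quadtree, so the parent lies outside the
      -- quadtree over `S` and ignores its shift.
      have hne : X.rootSet ω a ≠ S := by
        rw [← hSa']
        exact hX.rootSet_ne_pts ha.1 ha.2.2
      obtain ⟨h1, h2, h3⟩ := node_congr hS ha.1 hSa'.ge hne
      refine ⟨⟨h2, ?_⟩, ?_, ?_, fun l => ?_⟩
      · rw [h1]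
        exact ha.2
      · simp only [rootSet, h1, hSa']
      · simp only [node, h1]
      · simp only [node, h1, hSa', Cell.tripleShift_corner]
        ring

theorem update_mem_inTree_zero {S : Finset (Fin n)} {i : Fin n} (h : ω ∈ X.inTree S 0 i)
    (u : Fin d → ℝ) : Function.update ω S u ∈ X.inTree S 0 i := by
  obtain ⟨a, ha, hSa, hl, hi⟩ := h
  obtain ⟨h1, h2, h3, -⟩ := hX.root_congr (ω' := Function.update ω S u)
    (fun T hT => Function.update_of_ne hT _ _) ha hSa hl
  exact ⟨a, h1, h2, hl, by rwa [h3]⟩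

/-- If the points avoid the moats, then a small change of the shift of a quadtree does not affect
its larger cells. -/
theorem node_stable (hω : ω ∈ unitShifts n d) (he : ω ∈ X.avoidsMoats) {ω' : Shifts n d}
    {S : Finset (Fin n)} (hS : ∀ T, T ≠ S → ω' T = ω T) {a : Address d} (ha : X.IsNode ω a)
    (hSa : X.rootSet ω a = S)
    (hδ : level a = 0 ∨ ∀ l, |ω' S l - ω S l| * (2 ^ level a * (n : ℝ) ^ 4) < 3) :
    X.IsNode ω' a ∧ X.rootSet ω' a = S ∧ (X.node ω' a).pts = (X.node ω a).pts ∧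
      ∀ l, (X.node ω' a).cell.corner l =
        (X.node ω a).cell.corner l + (ω' S l - ω S l) * (X.box S).side := by
  induction a with
  | nil => exact hX.root_congr hS ha hSa rfl
  | cons s a ih =>
    cases s with
    | none => exact hX.root_congr hS ha hSa rfl
    | some v =>
      have hn := hX.cast_pos
      have hδ : ∀ l, |ω' S l - ω S l| * (2 ^ (level a + 1) * (n : ℝ) ^ 4) < 3 := by
        rcases hδ with h | h
        · simp [level] at h
        · exact h
      have hSa' : X.rootSet ω a = S := hSa
      obtain ⟨h1, h2, h3, h4⟩ := ih ha.1 hSa' <| Or.inr fun l => by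
        refine lt_of_le_of_lt ?_ (hδ l)
        gcongr
        · norm_num
        · omega
      have hside : (X.node ω' a).cell.side = (X.node ω a).cell.side := by
        rw [node_side, node_side, h2, hSa']
      have hw : 0 < (X.box S).side := hSa' ▸ hX.rootWidth_pos ha.1
      have hsmall : ¬ X.Small (X.node ω' a) := by
        unfold Small
        rw [h3, hside]
        exact ha.2.2.1
      -- The translation is shorter than the moat of the child, so every point stays in the child
      -- with the same index.
      have hmove : ∀ {i : Fin n} {w : Fin d → Fin 2}, i ∈ (X.node ω a).pts →
          X.pt i ∈ ((X.node ω a).cell.part 2 w).region →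
          X.pt i ∈ ((X.node ω' a).cell.part 2 w).region := by
        intro i w hi hw'
        have hchild : X.IsNode ω (some w :: a) :=
          ⟨ha.1, ha.2.1, ha.2.2.1, ⟨i, mem_pts_some.2 ⟨hi, hw'⟩⟩⟩
        refine Cell.mem_region_of_within (he _ hchild i hw').1 (by simp [node, hside])
          fun l => ?_
        have e1 : ((X.node ω' a).cell.part 2 w).corner l -
            (X.node ω (some w :: a)).cell.corner l = (ω' S l - ω S l) * (X.box S).side := by
          simp only [node, Cell.part_corner, h4, hside]
          ring
        rw [e1, abs_mul, abs_of_pos hw, node_side]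
        have e2 : X.rootSet ω (some w :: a) = S := hSa
        rw [e2, lt_div_iff₀ (by positivity)]
        have e3 : level (some w :: a) = level a + 1 := rfl
        rw [e3, lt_div_iff₀ (by positivity)]
        have := hδ l
        nlinarith
      have hpts : (X.node ω' (some v :: a)).pts = (X.node ω (some v :: a)).pts := by
        ext i
        rw [mem_pts_some, mem_pts_some, h3]
        -- Conversely, the child that held the point before still holds it, and the parts are
        -- disjoint.
        refine and_congr_right fun hi => ⟨fun hv => ?_, hmove hi⟩
        obtain ⟨w, hw'⟩ := Cell.exists_mem_region_part
          (hX.mem_region_of_mem_pts hω ha.1 hi) two_pos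
        rwa [Cell.part_unique hv (hmove hi hw')]
      refine ⟨⟨h1, by rw [h3]; exact ha.2.1, hsmall, by rw [hpts]; exact ha.2.2.2⟩, h2, hpts,
        fun l => ?_⟩
      simp only [node, Cell.part_corner, h4, hside]
      ring

/-- Avoidance is assumed only before the change and is not claimed after it. At level 0 no smallness
is needed, since building the quadtree does not depend on its own shift. -/
theorem update_mem_inTree (hω : ω ∈ unitShifts n d) (he : ω ∈ X.avoidsMoats)
    {S : Finset (Fin n)} {i : Fin n} {m J : ℕ} (h : ω ∈ X.inTree S m i) (u : Fin d → ℝ)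
    (hJ : m = 0 ∨ 2 ^ m * (n : ℝ) ^ 4 ≤ 2 ^ J) (hu : ∀ l, |u l - ω S l| < 1 / 2 ^ J) :
    Function.update ω S u ∈ X.inTree S m i := by
  obtain ⟨a, ha, hSa, hl, hi⟩ := h
  obtain ⟨h1, h2, h3, -⟩ := hX.node_stable hω he (ω' := Function.update ω S u)
    (fun T hT => Function.update_of_ne hT _ _) ha hSa <| by
      rw [hl]
      refine hJ.imp_right fun hJ l => ?_
      have := hu l
      rw [lt_div_iff₀ (by positivity)] at this
      rw [Function.update_self]
      have := mul_le_mul_of_nonneg_left hJ (abs_nonneg (u l - ω S l))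
      linarith
  exact ⟨a, h1, h2, hl, by rwa [h3]⟩

/-- Cells over a common point of comparable size belong to the same quadtree. -/
theorem eq_of_mem_inTree {S S' : Finset (Fin n)} {m m' : ℕ} {i : Fin n} {σ : ℝ}
    (h : ω ∈ X.inTree S m i) (h' : ω ∈ X.inTree S' m' i)
    (h1 : σ < 3 * (X.box S).side / 2 ^ m) (h2 : 3 * (X.box S).side / 2 ^ m ≤ (n : ℝ) ^ 8 * σ)
    (h1' : σ < 3 * (X.box S').side / 2 ^ m')
    (h2' : 3 * (X.box S').side / 2 ^ m' ≤ (n : ℝ) ^ 8 * σ) : S = S' := by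
  obtain ⟨a, ha, rfl, rfl, hi⟩ := h
  obtain ⟨b, hb, rfl, rfl, hi'⟩ := h'
  rw [← node_side] at h1 h2 h1' h2'
  have hn := hX.cast_pos
  have hn8 : (0 : ℝ) < (n : ℝ) ^ 8 := by positivity
  by_contra hne
  rcases le_total a.length b.length with hl | hl
  · have := hX.pow_mul_side_lt_of_rootSet_ne hb (ha.suffix_of_length_le hb hi hi' hl) hne
    nlinarith
  · have := hX.pow_mul_side_lt_of_rootSet_ne ha (hb.suffix_of_length_le ha hi' hi hl)
      (Ne.symm hne)
    nlinarith

-- The root sets above a fixed point form a chain under inclusion, so their cardinalities in `1, …,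
-- n` are distinct.
open Classical in
theorem card_roots_le (ω : Shifts n d) (i : Fin n) :
    (Finset.univ.filter fun S => ω ∈ X.inTree S 0 i).card ≤ n := by
  have hmaps : Set.MapsTo Finset.card
      ((Finset.univ.filter fun S => ω ∈ X.inTree S 0 i : Finset (Finset (Fin n))) :
        Set (Finset (Fin n))) (Finset.Icc 1 n : Finset ℕ) := by
    intro S hS
    obtain ⟨a, ha, rfl, -, -⟩ := (Finset.mem_filter.1 hS).2
    have h1 := hX.one_lt_card_rootSet ha
    have h2 := Finset.card_le_univ (X.rootSet ω a)
    rw [Fintype.card_fin] at h2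
    exact Finset.mem_coe.2 (Finset.mem_Icc.2 ⟨h1.le, h2⟩)
  have hinj : Set.InjOn Finset.card
      ((Finset.univ.filter fun S => ω ∈ X.inTree S 0 i : Finset (Finset (Fin n))) :
        Set (Finset (Fin n))) := by
    intro S hS T hT hST
    obtain ⟨a, ha, rfl, -, hi⟩ := (Finset.mem_filter.1 hS).2
    obtain ⟨b, hb, rfl, -, hi'⟩ := (Finset.mem_filter.1 hT).2
    rcases le_total a.length b.length with hl | hl
    · exact (Finset.eq_of_subset_of_card_le
        (rootSet_subset_of_suffix (ha.suffix_of_length_le hb hi hi' hl)) hST.le).symm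
    · exact Finset.eq_of_subset_of_card_le
        (rootSet_subset_of_suffix (hb.suffix_of_length_le ha hi' hi hl)) hST.ge
  simpa using Finset.card_le_card_of_injOn _ hmaps hinj

/-- A quadtree is divided only boundedly many times between two losses of points. -/
theorem level_le (hω : ω ∈ unitShifts n d) {L : ℕ} (hL : 3 * (n : ℝ) ^ 8 ≤ X.eps * 2 ^ L)
    {a : Address d} (ha : X.IsNode ω a) : level a ≤ n * (L + 1) := by
  have hn := hX.cast_pos
  -- Here `t` counts divisions since the last loss of points or the last root. Meanwhile the box is
  -- fixed and the side halves, so the first failed compression test yields the factor `2 ^ t`,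
  -- whence `t ≤ L`. Each lost point pays for `L + 1` levels.
  have key : ∃ t, level a + (X.node ω a).pts.card * (L + 1) ≤ n * (L + 1) + t ∧
      (t = 0 ∨ X.eps * (X.node ω a).cell.side * 2 ^ t / (3 * (n : ℝ) ^ 8) ≤
        (X.box (X.node ω a).pts).side) ∧ t ≤ L := by
    have bound : ∀ (b : Address d) (t : ℕ), X.IsNode ω b →
        X.eps * (X.node ω b).cell.side * 2 ^ t / (3 * (n : ℝ) ^ 8) ≤
        (X.box (X.node ω b).pts).side → t ≤ L := by
      intro b t hb h
      have h1 := h.trans (hX.width_pts_le_side hω hb)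
      have h2 := hX.side_pos hb
      have h3 := X.eps_pos
      rw [div_le_iff₀ (by positivity)] at h1
      have h4 : X.eps * (X.node ω b).cell.side * 2 ^ t ≤
          X.eps * (X.node ω b).cell.side * 2 ^ L := by nlinarith
      have h5 := le_of_mul_le_mul_left h4 (by positivity)
      exact (pow_le_pow_iff_right₀ (one_lt_two : (1 : ℝ) < 2)).1 h5
    have hcard : ∀ b : Address d, (X.node ω b).pts.card ≤ n := fun b => by
      simpa using Finset.card_le_univ (X.node ω b).pts
    induction a with
    | nil =>
      refine ⟨0, ?_, Or.inl rfl, by omega⟩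
      have := Nat.mul_le_mul_right (L + 1) (hcard [])
      simpa [level] using this
    | cons s a ih =>
      cases s with
      | none =>
        refine ⟨0, ?_, Or.inl rfl, by omega⟩
        have := Nat.mul_le_mul_right (L + 1) (hcard (none :: a))
        simpa [level] using this
      | some v =>
        obtain ⟨t, h1, h2, h3⟩ := ih ha.1
        have hns : ¬ X.Small (X.node ω a) := ha.2.2.1
        unfold Small at hns
        push Not at hns
        have hsub := pts_cons_subset (X := X) (ω := ω) (some v) a
        rcases eq_or_ne (X.node ω (some v :: a)).pts (X.node ω a).pts with heq | hne
        · have hb : X.eps * (X.node ω (some v :: a)).cell.side * 2 ^ (t + 1) /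
              (3 * (n : ℝ) ^ 8) ≤ (X.box (X.node ω (some v :: a)).pts).side := by
            rw [heq]
            have e : X.eps * (X.node ω (some v :: a)).cell.side * 2 ^ (t + 1) =
                X.eps * (X.node ω a).cell.side * 2 ^ t := by
              simp only [node, Cell.part_side, pow_succ]
              push_cast
              ring
            rw [e]
            rcases h2 with rfl | h2
            · simpa using hns
            · exact h2
          refine ⟨t + 1, ?_, Or.inr hb, bound _ _ ha hb⟩
          rw [heq]
          simp only [level]
          omega
        · refine ⟨0, ?_, Or.inl rfl, by omega⟩
          have hlt := Finset.card_lt_card (hsub.ssubset_of_ne hne)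
          have := Nat.mul_le_mul_right (L + 1) (Nat.succ_le_of_lt hlt)
          rw [Nat.succ_mul] at this
          simp only [level]
          omega
  obtain ⟨t, h1, -, h3⟩ := key
  have := Finset.card_pos.2 (hX.pts_nonempty ha)
  have := Nat.mul_le_mul_right (L + 1) this
  omega

end Regular

end Config


/-! ### Probabilities of moat violations and of separation -/

theorem mem_progression {b w u lo hi τ : ℝ} (hw : 0 < w) (c : ℤ)
    (h1 : lo ≤ b - w + u * w + c * (τ * w)) (h2 : b - w + u * w + c * (τ * w) ≤ hi) :
    u ∈ progression ((lo - b + w) / w) τ ((hi - lo) / w) := by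
  refine Set.mem_iUnion.2 ⟨-c, ?_, ?_⟩
  · have : (lo - b + w) / w ≤ u + c * τ := by
      rw [div_le_iff₀ hw]
      linarith
    push_cast
    linarith
  · have : u + c * τ ≤ (lo - b + w) / w + (hi - lo) / w := by
      rw [← add_div, le_div_iff₀ hw]
      linarith
    push_cast
    linarith

namespace Config

variable {n d : ℕ} {X : Config n d} {ω : Shifts n d}

/-- The shifts for which a hyperplane of the grid of level `m` of the quadtree over `S` meets the
interval `[lo, hi]`. -/
def gridHit (X : Config n d) (S : Finset (Fin n)) (m : ℕ) (lo hi : ℝ) (l : Fin d) : Set ℝ :=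
  progression ((lo - (X.box S).corner l + (X.box S).side) / (X.box S).side) (3 / 2 ^ m)
    ((hi - lo) / (X.box S).side)

theorem mem_gridHit {S : Finset (Fin n)} (hS : 0 < (X.box S).side) {m : ℕ} {lo hi u : ℝ}
    {l : Fin d} (c : ℤ)
    (h1 : lo ≤ (X.box S).corner l - (X.box S).side + u * (X.box S).side +
      c * (3 * (X.box S).side / 2 ^ m))
    (h2 : (X.box S).corner l - (X.box S).side + u * (X.box S).side +
      c * (3 * (X.box S).side / 2 ^ m) ≤ hi) : u ∈ X.gridHit S m lo hi l := by
  have e : 3 * (X.box S).side / 2 ^ m = 3 / 2 ^ m * (X.box S).side := by ring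
  rw [e] at h1 h2
  exact mem_progression hS c h1 h2

/-- One level of slack is affordable because the root has three times the side of the box: `3 / 2 ^
m` is at least `1 / 2 ^ J` already for `m = J + 1`. -/
theorem volume_gridHit_le {S : Finset (Fin n)} (hS : 0 ≤ (X.box S).side) {m J : ℕ}
    (hJ : m ≤ J + 1) {lo hi : ℝ} (hle : lo ≤ hi) (l : Fin d) (q : Fin (2 ^ J)) :
    volume (X.gridHit S m lo hi l ∩ dyadic J q) ≤
      ENNReal.ofReal (2 * ((hi - lo) / (X.box S).side) * 2 ^ J) * volume (dyadic J q) := by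
  refine volume_progression_inter_dyadic_le _ J q ?_ (div_nonneg (by linarith) hS)
  have : (2 : ℝ) ^ m ≤ 2 ^ (J + 1) := pow_le_pow_right₀ (by norm_num) hJ
  rw [pow_succ] at this
  rw [div_le_div_iff₀ (by positivity) (by positivity)]
  nlinarith [(by positivity : (0 : ℝ) < 2 ^ J)]

/-- The shifts for which the point `i` is in a moat of level `m` of the quadtree over `S`. -/
def nearGrid (X : Config n d) (S : Finset (Fin n)) (m : ℕ) (i : Fin n) (l : Fin d) : Set ℝ :=
  X.gridHit S m (X.pt i l - 3 * (X.box S).side / 2 ^ m / (n : ℝ) ^ 4)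
    (X.pt i l + 3 * (X.box S).side / 2 ^ m / (n : ℝ) ^ 4) l

theorem exists_mem_nearGrid {S : Finset (Fin n)} (hS : 0 < (X.box S).side) {m : ℕ} {i : Fin n}
    {C : Cell d} {u : Fin d → ℝ} (hs : C.side = 3 * (X.box S).side / 2 ^ m) (c : Fin d → ℤ)
    (hc : ∀ l, C.corner l = (X.box S).corner l - (X.box S).side + u l * (X.box S).side +
      c l * (3 * (X.box S).side / 2 ^ m))
    (hi : X.pt i ∈ C.region) (h : ¬ C.Within (C.side / (n : ℝ) ^ 4) (X.pt i)) :
    ∃ l, u l ∈ X.nearGrid S m i l := by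
  unfold Cell.Within at h
  push Not at h
  obtain ⟨l, hl⟩ := h
  have h1 := hi l
  refine ⟨l, ?_⟩
  rw [hs] at hl h1
  have hcl := hc l
  have hpos : 0 < 3 * (X.box S).side / 2 ^ m / (n : ℝ) ^ 4 := by
    have : 0 < n := i.pos
    positivity
  by_cases hlow : C.corner l + 3 * (X.box S).side / 2 ^ m / (n : ℝ) ^ 4 ≤ X.pt i l
  · have hl := hl hlow
    refine mem_gridHit hS (c l + 1) ?_ ?_
    · push_cast
      linarith
    · push_cast
      linarith
  · push Not at hlow
    refine mem_gridHit hS (c l) ?_ ?_ <;> linarith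

/-- Subcells continue the dyadic grid of the quadtree `k` levels further, so their moats are moats
of that finer level. -/
theorem region_corner (X : Config n d) (ω : Shifts n d) (a : Address d)
    (v : Fin d → Fin (2 ^ X.k)) :
    ∃ c : Fin d → ℤ, ∀ j, (X.region ω a v).corner j =
      (X.box (X.rootSet ω a)).corner j - (X.box (X.rootSet ω a)).side +
        ω (X.rootSet ω a) j * (X.box (X.rootSet ω a)).side +
        c j * (3 * (X.box (X.rootSet ω a)).side / 2 ^ (level a + X.k)) := by
  obtain ⟨c, hc⟩ := X.node_corner ω a
  refine ⟨fun j => c j * 2 ^ X.k + (v j : ℕ), fun j => ?_⟩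
  simp only [region, Cell.part_corner, hc, node_side, pow_add]
  push_cast
  field_simp
  ring

namespace Regular

variable (hX : X.Regular)
include hX

/-- The moat condition concerns all points in the region of the cell. Clear shallower nodes
guarantee that such a point belongs to the node, and hence that the quadtree is built over it. -/
theorem exists_nearGrid_of_not_clear (hω : ω ∈ unitShifts n d) {a : Address d}
    (ha : X.IsNode ω a)
    (hclear : ∀ b : Address d, b.length < a.length → X.IsNode ω b → X.Clear ω b)
    (h : ¬ X.Clear ω a) : ∃ i S m, m ≤ level a + X.k ∧ ω ∈ X.inTree S 0 i ∧
      ∃ l, ω S l ∈ X.nearGrid S m i l := by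
  unfold Clear at h
  push Not at h
  obtain ⟨i, hi, hne⟩ := h
  have hpts := hX.mem_pts_of_mem_region hω ha hclear hi
  have hw := hX.rootWidth_pos ha
  refine ⟨i, X.rootSet ω a, ?_⟩
  have hin := ha.mem_inTree hpts (Nat.zero_le _)
  by_cases h1 : (X.node ω a).cell.Within ((X.node ω a).cell.side / (n : ℝ) ^ 4) (X.pt i)
  · obtain ⟨v, hv, hnv⟩ := hne h1
    obtain ⟨c, hc⟩ := X.region_corner ω a v
    refine ⟨level a + X.k, le_rfl, hin, exists_mem_nearGrid hw ?_ c hc hv ?_⟩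
    · rw [region_side, node_side, pow_add]
      unfold eps
      field_simp
    · rwa [region_side]
  · obtain ⟨c, hc⟩ := X.node_corner ω a
    exact ⟨level a, by omega, hin, exists_mem_nearGrid hw (X.node_side ω a) c hc hi h1⟩

/-- Apply the preceding argument to a violating node of least depth. -/
theorem exists_nearGrid (hω : ω ∈ unitShifts n d) (he : ω ∉ X.avoidsMoats) {D : ℕ}
    (hD : ∀ a, X.IsNode ω a → level a ≤ D) :
    ∃ i S m, m < D + X.k + 1 ∧ ω ∈ X.inTree S 0 i ∧ ∃ l, ω S l ∈ X.nearGrid S m i l := by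
  have hex : ∃ N : ℕ, ∃ a : Address d, a.length = N ∧ X.IsNode ω a ∧ ¬ X.Clear ω a := by
    by_contra! h
    exact he fun a ha => h _ a rfl ha
  classical
  obtain ⟨a, hlen, ha, hna⟩ := Nat.find_spec hex
  obtain ⟨i, S, m, hm, h⟩ := hX.exists_nearGrid_of_not_clear hω ha (fun b hb hbn => by
    by_contra hbc
    exact Nat.find_min hex (hlen ▸ hb) ⟨b, rfl, hbn, hbc⟩) hna
  have := hD a ha
  exact ⟨i, S, m, by omega, h⟩

/-- Replaces a union bound over exponentially many sets `S` by the expected number of quadtrees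
built over the point. -/
theorem sum_measure_inTree_le (i : Fin n) :
    ∑ S, shiftMeasure n d (X.inTree S 0 i) ≤ n := by
  classical
  have hm := fun S => X.measurableSet_inTree S 0 i
  calc ∑ S, shiftMeasure n d (X.inTree S 0 i)
      = ∫⁻ ω, ∑ S, (X.inTree S 0 i).indicator 1 ω ∂shiftMeasure n d := by
        rw [lintegral_finsetSum _ fun S _ => measurable_one.indicator (hm S)]
        simp only [lintegral_indicator_one (hm _)]
    _ ≤ ∫⁻ _, n ∂shiftMeasure n d := by
        refine lintegral_mono fun ω => ?_
        have := hX.card_roots_le ω i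
        simp only [Set.indicator_apply, Pi.one_apply, Finset.sum_boole]
        exact_mod_cast this
    _ = n := by simp

/-- That the quadtree over `S` is built is independent of its shift, so the event serves as both `R`
and `T`. A moat has width 6/n^4 relative to `w / 2 ^ m`, where w is the side of the box, and the
density bound doubles it. -/
theorem measure_nearGrid_le (i : Fin n) (S : Finset (Fin n)) (m : ℕ) :
    shiftMeasure n d (X.inTree S 0 i ∩ {ω | ∃ l, ω S l ∈ X.nearGrid S m i l}) ≤
      d * ENNReal.ofReal (12 / (n : ℝ) ^ 4) * shiftMeasure n d (X.inTree S 0 i) := by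
  rcases S.eq_empty_or_nonempty with rfl | hS
  · have : X.inTree ∅ 0 i = ∅ := by
      ext ω
      refine iff_of_false ?_ (Set.notMem_empty _)
      rintro ⟨a, ha, h, -⟩
      simpa [h] using hX.one_lt_card_rootSet ha
    simp [this]
  have hw := hX.width_nonneg hS
  have hn := hX.cast_pos
  refine shiftMeasure_inter_le S m (X.measurableSet_inTree S 0 i) (X.measurableSet_inTree S 0 i)
    (fun l => measurableSet_progression _ _ _) (fun l q => ?_)
    (fun ω hω u _ _ => hX.update_mem_inTree_zero hω u)
  have hpos : 0 ≤ 3 * (X.box S).side / 2 ^ m / (n : ℝ) ^ 4 := by positivity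
  refine (volume_gridHit_le hw (by omega) (by linarith) l q).trans ?_
  gcongr
  have e : 2 * ((X.pt i l + 3 * (X.box S).side / 2 ^ m / (n : ℝ) ^ 4 -
      (X.pt i l - 3 * (X.box S).side / 2 ^ m / (n : ℝ) ^ 4)) / (X.box S).side) * 2 ^ m =
      12 / (n : ℝ) ^ 4 * ((X.box S).side / (X.box S).side) := by
    field_simp
    ring
  rw [e]
  exact mul_le_of_le_one_right (by positivity) (div_self_le_one _)

/-- A union bound for the probability that some point lies in a moat. -/
theorem measure_compl_avoidsMoats_le {L : ℕ} (hL : 3 * (n : ℝ) ^ 8 ≤ X.eps * 2 ^ L) :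
    shiftMeasure n d X.avoidsMoatsᶜ ≤
      ENNReal.ofReal (n * (n * (n * (L + 1) + X.k + 1)) * (d * (12 / (n : ℝ) ^ 4))) := by
  set D := n * (L + 1) with hD
  set A : Fin n → Finset (Fin n) → ℕ → Set (Shifts n d) := fun i S m =>
    X.inTree S 0 i ∩ {ω | ∃ l, ω S l ∈ X.nearGrid S m i l} with hA
  have hcover : ∀ᵐ ω ∂shiftMeasure n d, ω ∈ X.avoidsMoatsᶜ →
      ω ∈ ⋃ i, ⋃ S, ⋃ m ∈ Finset.range (D + X.k + 1), A i S m := by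
    filter_upwards [ae_mem_unitShifts n d] with ω hω he
    obtain ⟨i, S, m, hm, h1, h2⟩ :=
      hX.exists_nearGrid hω he (D := D) fun a ha => hX.level_le hω hL ha
    simp only [Set.mem_iUnion]
    exact ⟨i, S, m, Finset.mem_range.2 hm, h1, h2⟩
  have hc : (0 : ℝ) ≤ 12 / (n : ℝ) ^ 4 := by positivity
  calc shiftMeasure n d X.avoidsMoatsᶜ
      ≤ shiftMeasure n d (⋃ i, ⋃ S, ⋃ m ∈ Finset.range (D + X.k + 1), A i S m) :=
        measure_mono_ae hcover
    _ ≤ ∑ i, ∑ S, ∑ m ∈ Finset.range (D + X.k + 1), shiftMeasure n d (A i S m) := by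
        refine (measure_iUnion_fintype_le _ _).trans (Finset.sum_le_sum fun i _ => ?_)
        refine (measure_iUnion_fintype_le _ _).trans (Finset.sum_le_sum fun S _ => ?_)
        exact measure_biUnion_finset_le _ _
    _ ≤ ∑ i, ∑ S, ∑ _m ∈ Finset.range (D + X.k + 1),
          d * ENNReal.ofReal (12 / (n : ℝ) ^ 4) * shiftMeasure n d (X.inTree S 0 i) := by
        gcongr with i _ S _ m _
        exact hX.measure_nearGrid_le i S m
    _ = (D + X.k + 1 : ℕ) * (d * ENNReal.ofReal (12 / (n : ℝ) ^ 4)) *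
          ∑ i, ∑ S, shiftMeasure n d (X.inTree S 0 i) := by
        simp only [Finset.sum_const, Finset.card_range, nsmul_eq_mul, Finset.mul_sum, mul_assoc]
    _ ≤ (D + X.k + 1 : ℕ) * (d * ENNReal.ofReal (12 / (n : ℝ) ^ 4)) * ∑ _i : Fin n, (n : ℝ≥0∞) := by
        gcongr with i _
        exact hX.sum_measure_inTree_le i
    _ = ENNReal.ofReal (n * (n * (n * (L + 1) + X.k + 1)) * (d * (12 / (n : ℝ) ^ 4))) := by
        rw [Finset.sum_const, Finset.card_univ, Fintype.card_fin, nsmul_eq_mul]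
        rw [← ENNReal.ofReal_natCast n, ← ENNReal.ofReal_natCast d,
          ← ENNReal.ofReal_natCast (D + X.k + 1), ← ENNReal.ofReal_mul (by positivity),
          ← ENNReal.ofReal_mul (by positivity), ← ENNReal.ofReal_mul (by positivity),
          ← ENNReal.ofReal_mul (by positivity)]
        congr 1
        rw [hD]
        push_cast
        ring

/-- The separating midplane of the cell is a hyperplane of the next finer grid, with odd index `2 *
c l + 1`. -/
theorem exists_gridHit_of_splits {i j : Fin n} {a : Address d} (h : X.Splits ω i j a) :
    ∃ l, ω (X.rootSet ω a) l ∈ X.gridHit (X.rootSet ω a) (level a + 1)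
      (min (X.pt i l) (X.pt j l)) (max (X.pt i l) (X.pt j l)) l := by
  obtain ⟨ha, -, -, -, v, w, hvw, hv, hw⟩ := h
  obtain ⟨l, hl⟩ := Function.ne_iff.1 hvw
  obtain ⟨c, hc⟩ := X.node_corner ω a
  have h1 := hv l
  have h2 := hw l
  have hpos := hX.rootWidth_pos ha
  simp only [Cell.part_corner, Cell.part_side, hc, node_side] at h1 h2
  have e : 3 * (X.box (X.rootSet ω a)).side / 2 ^ level a =
      2 * (3 * (X.box (X.rootSet ω a)).side / 2 ^ (level a + 1)) := by
    rw [pow_succ]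
    field_simp
  rw [e] at h1 h2
  push_cast at h1 h2
  refine ⟨l, mem_gridHit hpos (2 * c l + 1) ?_ ?_⟩
  all_goals
    push_cast
    generalize 3 * (X.box (X.rootSet ω a)).side / 2 ^ (level a + 1) = s at h1 h2 ⊢
    generalize v l = p at *
    generalize w l = q at *
    fin_cases p <;> fin_cases q
    · exact absurd rfl hl
    · simp at h1 h2 ⊢
      first
        | left; linarith
        | right; linarith
    · simp at h1 h2 ⊢
      first
        | left; linarith
        | right; linarith
    · exact absurd rfl hl

/-- The probability that two points are separated at a given scale is at most proportional to
their distance. -/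
theorem measure_splits_le (i j : Fin n) {σ : ℝ} (hσ : 0 < σ) :
    shiftMeasure n d {ω | ω ∈ X.avoidsMoats ∧ ∃ a, X.Splits ω i j a ∧
      σ < (X.node ω a).cell.side ∧ (X.node ω a).cell.side ≤ 2 * σ} ≤
      d * ENNReal.ofReal (6 * dist (X.pt i) (X.pt j) / σ) := by
  have hn2 := hX.two_le
  have hn := hX.cast_pos
  -- Going up `p` levels widens the moats beyond the effect of shift changes below `2 ^ (-m)`, and
  -- keeps cell sides at most `n ^ 8 * σ`, within the gap between nested quadtrees.
  obtain ⟨p, hp1, hp2⟩ : ∃ p : ℕ, (n : ℝ) ^ 4 ≤ 2 ^ p ∧ (2 : ℝ) ^ (p + 1) ≤ (n : ℝ) ^ 8 := by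
    have h4 : 2 ^ 4 ≤ n ^ 4 := Nat.pow_le_pow_left hn2 4
    have hlt : 2 ^ (Nat.clog 2 (n ^ 4)).pred < n ^ 4 :=
      Nat.pow_pred_clog_lt_self one_lt_two (by omega)
    have hge : n ^ 4 ≤ 2 ^ Nat.clog 2 (n ^ 4) := Nat.le_pow_clog one_lt_two _
    have hpos : 0 < Nat.clog 2 (n ^ 4) := Nat.clog_pos one_lt_two (by omega)
    refine ⟨Nat.clog 2 (n ^ 4), by exact_mod_cast hge, ?_⟩
    obtain ⟨q, hq⟩ : ∃ q, Nat.clog 2 (n ^ 4) = q + 1 := ⟨_, (Nat.succ_pred hpos.ne').symm⟩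
    rw [hq, Nat.pred_succ] at hlt
    rw [hq]
    have : 2 ^ (q + 1 + 1) ≤ n ^ 8 := by
      calc 2 ^ (q + 1 + 1) = 2 ^ q * 4 := by ring
        _ ≤ n ^ 4 * n ^ 4 := Nat.mul_le_mul hlt.le (by omega)
        _ = n ^ 8 := by ring
    exact_mod_cast this
  let I := {q : Finset (Fin n) × ℕ // σ < 3 * (X.box q.1).side / 2 ^ q.2 ∧
    3 * (X.box q.1).side / 2 ^ q.2 ≤ 2 * σ}
  have hsize : ∀ q : I, σ < 3 * (X.box q.1.1).side / 2 ^ (q.1.2 - p) ∧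
      3 * (X.box q.1.1).side / 2 ^ (q.1.2 - p) ≤ (n : ℝ) ^ 8 * σ := by
    rintro ⟨⟨S, m⟩, h1, h2⟩
    simp only at h1 h2 ⊢
    have hw : 0 < 3 * (X.box S).side := by
      by_contra! h
      have := div_nonpos_of_nonpos_of_nonneg h (by positivity : (0 : ℝ) ≤ 2 ^ m)
      linarith
    constructor
    · refine h1.trans_le (div_le_div_of_nonneg_left hw.le (by positivity) ?_)
      exact pow_le_pow_right₀ (by norm_num) (by omega)
    · calc 3 * (X.box S).side / 2 ^ (m - p) ≤ 2 ^ p * (3 * (X.box S).side / 2 ^ m) := by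
            rw [← mul_div_assoc, div_le_div_iff₀ (by positivity) (by positivity)]
            have : (2 : ℝ) ^ m ≤ 2 ^ p * 2 ^ (m - p) := by
              rw [← pow_add]
              exact pow_le_pow_right₀ (by norm_num) (by omega)
            nlinarith
        _ ≤ 2 ^ p * (2 * σ) := by gcongr
        _ = 2 ^ (p + 1) * σ := by ring
        _ ≤ _ := by gcongr
  let A : I → Set (Shifts n d) := fun q => X.inTree q.1.1 (q.1.2 - p) i
  have hAm : ∀ q, MeasurableSet (A q) := fun q => X.measurableSet_inTree _ _ _
  -- The size gap determines `S`; then only one level has cell side in `(σ, 2σ]`.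
  have hAd : Pairwise (Function.onFun Disjoint A) := by
    intro q q' hne
    rw [Function.onFun, Set.disjoint_left]
    intro ω h h'
    apply hne
    have hS := hX.eq_of_mem_inTree h h' (hsize q).1 (hsize q).2 (hsize q').1 (hsize q').2
    obtain ⟨⟨S, m⟩, h1, h2⟩ := q
    obtain ⟨⟨S', m'⟩, h1', h2'⟩ := q'
    obtain rfl : S = S' := hS
    simp only at h1 h2 h1' h2'
    have key : ∀ {m m' : ℕ}, σ < 3 * (X.box S).side / 2 ^ m →
        3 * (X.box S).side / 2 ^ m' ≤ 2 * σ → m ≤ m' := by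
      intro m m' h1 h2
      by_contra! h
      have e : 3 * (X.box S).side / 2 ^ (m' + 1) ≤ σ := by
        rw [pow_succ, ← div_div]
        linarith
      have hw : 0 < 3 * (X.box S).side := by
        by_contra! h
        have := div_nonpos_of_nonpos_of_nonneg h (by positivity : (0 : ℝ) ≤ 2 ^ m)
        linarith
      have : 3 * (X.box S).side / 2 ^ m ≤ 3 * (X.box S).side / 2 ^ (m' + 1) :=
        div_le_div_of_nonneg_left hw.le (by positivity) (pow_le_pow_right₀ (by norm_num) h)
      linarith
    obtain rfl : m = m' := (key h1 h2').antisymm (key h1' h2)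
    rfl
  let B : I → Fin d → Set ℝ := fun q l => X.gridHit q.1.1 (q.1.2 + 1)
    (min (X.pt i l) (X.pt j l)) (max (X.pt i l) (X.pt j l)) l
  -- Stability needs avoidance, so it is built into `R`; the enlarged events `A` omit it and remain
  -- disjoint.
  let R : I → Set (Shifts n d) := fun q => X.avoidsMoats ∩ unitShifts n d ∩ A q
  have hR : ∀ q, shiftMeasure n d (R q ∩ {ω | ∃ l, ω q.1.1 l ∈ B q l}) ≤
      d * ENNReal.ofReal (6 * dist (X.pt i) (X.pt j) / σ) * shiftMeasure n d (A q) := by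
    intro q
    have hq := q.2
    have hw : 0 < (X.box q.1.1).side := by
      by_contra! h
      have := div_nonpos_of_nonpos_of_nonneg (by linarith : 3 * (X.box q.1.1).side ≤ 0)
        (by positivity : (0 : ℝ) ≤ 2 ^ q.1.2)
      linarith
    refine shiftMeasure_inter_le q.1.1 q.1.2 ((X.measurableSet_avoidsMoats.inter
      (measurableSet_unitShifts n d)).inter (hAm q)) (hAm q)
      (fun l => measurableSet_progression _ _ _) (fun l m => ?_) ?_
    · refine (volume_gridHit_le hw.le le_rfl (min_le_max) l m).trans ?_
      gcongr
      rw [max_sub_min_eq_abs, le_div_iff₀ hσ]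
      have h1 := Cell.abs_sub_le_dist (X.pt j) (X.pt i) l
      rw [dist_comm] at h1
      have h2 : σ * 2 ^ q.1.2 / (X.box q.1.1).side ≤ 3 := by
        rw [div_le_iff₀ hw]
        have := (lt_div_iff₀ (by positivity)).1 hq.1
        exact this.le
      calc 2 * (|X.pt j l - X.pt i l| / (X.box q.1.1).side) * 2 ^ q.1.2 * σ
          = 2 * |X.pt j l - X.pt i l| * (σ * 2 ^ q.1.2 / (X.box q.1.1).side) := by ring
        _ ≤ 2 * dist (X.pt i) (X.pt j) * 3 := by gcongr
        _ = _ := by ring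
    · rintro ω ⟨⟨he, hω⟩, hin⟩ u - hu
      refine hX.update_mem_inTree hω he hin u ?_ hu
      -- If `m ≤ p` the subtraction gives level 0, where any change of the shift is allowed.
      rcases Nat.eq_zero_or_pos (q.1.2 - p) with h0 | h0
      · exact Or.inl h0
      · right
        calc (2 : ℝ) ^ (q.1.2 - p) * (n : ℝ) ^ 4 ≤ 2 ^ (q.1.2 - p) * 2 ^ p := by gcongr
          _ = 2 ^ q.1.2 := by rw [← pow_add]; congr 1; omega
  have hcover : ∀ᵐ ω ∂shiftMeasure n d, ω ∈ {ω | ω ∈ X.avoidsMoats ∧ ∃ a, X.Splits ω i j a ∧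
      σ < (X.node ω a).cell.side ∧ (X.node ω a).cell.side ≤ 2 * σ} →
      ω ∈ ⋃ q, R q ∩ {ω | ∃ l, ω q.1.1 l ∈ B q l} := by
    filter_upwards [ae_mem_unitShifts n d] with ω hω ⟨he, a, hs, h1, h2⟩
    rw [node_side] at h1 h2
    refine Set.mem_iUnion.2 ⟨⟨(X.rootSet ω a, level a), h1, h2⟩, ⟨⟨he, hω⟩, ?_⟩,
      hX.exists_gridHit_of_splits hs⟩
    exact hs.1.mem_inTree hs.2.1 (Nat.sub_le _ _)
  calc _ ≤ shiftMeasure n d (⋃ q, R q ∩ {ω | ∃ l, ω q.1.1 l ∈ B q l}) := measure_mono_ae hcover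
    _ ≤ ∑' q, shiftMeasure n d (R q ∩ {ω | ∃ l, ω q.1.1 l ∈ B q l}) := measure_iUnion_le _
    _ ≤ ∑' q, d * ENNReal.ofReal (6 * dist (X.pt i) (X.pt j) / σ) * shiftMeasure n d (A q) :=
        ENNReal.tsum_le_tsum hR
    _ = d * ENNReal.ofReal (6 * dist (X.pt i) (X.pt j) / σ) * ∑' q, shiftMeasure n d (A q) :=
        ENNReal.tsum_mul_left
    _ ≤ d * ENNReal.ofReal (6 * dist (X.pt i) (X.pt j) / σ) * 1 := by
        gcongr
        rw [← measure_iUnion hAd hAm]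
        exact prob_le_one
    _ = _ := mul_one _

end Regular

end Config


/-! ### Conditional expectation of the distance -/

namespace Config

variable {n d : ℕ} {X : Config n d} {ω : Shifts n d}

/-- The points `i` and `j` are separated below a cell of side between `σ` and `2 * σ`. -/
def splitsAt (X : Config n d) (i j : Fin n) (σ : ℝ) : Set (Shifts n d) :=
  {ω | ω ∈ X.avoidsMoats ∧ ∃ a, X.Splits ω i j a ∧
      σ < (X.node ω a).cell.side ∧ (X.node ω a).cell.side ≤ 2 * σ}

theorem measurableSet_splitsAt (X : Config n d) (i j : Fin n) (σ : ℝ) :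
    MeasurableSet (X.splitsAt i j σ) := by
  refine X.measurableSet_avoidsMoats.inter (measurableSet_setOfPred.2 (Measurable.exists fun a =>
    Measurable.and ?_ (Measurable.and ?_ ?_)))
  · refine (X.measurable_isNode a).and ((X.measurable_mem_pts a i).and
      ((X.measurable_mem_pts a j).and ((X.measurable_small a).not.and
      (Measurable.exists fun v => Measurable.exists fun w => measurable_const.and ?_))))
    exact (((X.measurable_cell a).part 2 v).mem_region _).and
      (((X.measurable_cell a).part 2 w).mem_region _)
  · exact measurableSet_setOfPred.1 (measurableSet_lt measurable_const (X.measurable_cell a).side)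
  · exact measurableSet_setOfPred.1 (measurableSet_le (X.measurable_cell a).side measurable_const)

namespace Regular

variable (hX : X.Regular)
include hX

theorem graphDist_le_of_avoidsMoats (hω : ω ∈ unitShifts n d) (he : ω ∈ X.avoidsMoats)
    {i j : Fin n} (hij : i ≠ j) : X.graphDist ω (.point i) (.point j) ≤
      ENNReal.ofReal ((1 + 6 * d * X.eps * (n : ℝ) ^ 4) * dist (X.pt i) (X.pt j)) := by
  obtain ⟨a, ha⟩ := hX.exists_splits hω hij
  refine (hX.graphDist_le hω he ha).trans (ENNReal.ofReal_le_ofReal ?_)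
  have h1 := hX.side_le_of_splits he ha
  have h2 := X.eps_pos
  have : 6 * d * X.eps * (X.node ω a).cell.side ≤
      6 * d * X.eps * ((n : ℝ) ^ 4 * dist (X.pt i) (X.pt j)) := by gcongr
  linarith

/-- A separating cell of side at most r costs the fixed term. A larger one has side at most n^4 r
and falls into one of `T` dyadic scales. -/
theorem graphDist_le_sum (hω : ω ∈ unitShifts n d) (he : ω ∈ X.avoidsMoats)
    {i j : Fin n} (hij : i ≠ j) {T : ℕ} (hT : (n : ℝ) ^ 4 ≤ 2 ^ T) :
    X.graphDist ω (.point i) (.point j) ≤ ENNReal.ofReal (dist (X.pt i) (X.pt j)) +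
      (ENNReal.ofReal (6 * d * X.eps * dist (X.pt i) (X.pt j)) +
      ∑ t ∈ Finset.range T, (X.splitsAt i j (dist (X.pt i) (X.pt j) * 2 ^ t)).indicator
        (fun _ => ENNReal.ofReal (12 * d * X.eps * dist (X.pt i) (X.pt j) * 2 ^ t)) ω) := by
  obtain ⟨a, ha⟩ := hX.exists_splits hω hij
  have he0 := X.eps_pos
  have hr : 0 < dist (X.pt i) (X.pt j) := dist_pos.2 (hX.inj.ne hij)
  refine (hX.graphDist_le hω he ha).trans ?_
  have hs := hX.side_le_of_splits he ha
  have hs0 := hX.side_pos ha.1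
  rw [ENNReal.ofReal_add hr.le (by positivity)]
  gcongr
  generalize dist (X.pt i) (X.pt j) = r at *
  by_cases h1 : (X.node ω a).cell.side ≤ r
  · refine le_add_right (ENNReal.ofReal_le_ofReal ?_)
    gcongr
  push Not at h1
  refine le_add_left ?_
  -- The least such `t` is positive, so its predecessor is the scale sought.
  have hex : ∃ t, (X.node ω a).cell.side ≤ r * 2 ^ t := ⟨T, hs.trans (by nlinarith)⟩
  classical
  have hspec := Nat.find_spec hex
  have hpos : Nat.find hex ≠ 0 := by
    intro h
    rw [h] at hspec
    simp at hspec
    linarith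
  obtain ⟨t, ht⟩ := Nat.exists_eq_succ_of_ne_zero hpos
  have hlt : r * 2 ^ t < (X.node ω a).cell.side := by
    have := Nat.find_min hex (m := t) (by omega)
    linarith
  have htT : t < T := by
    have h2 : r * 2 ^ t < r * 2 ^ T := hlt.trans_le (hs.trans (by nlinarith))
    exact (pow_lt_pow_iff_right₀ (one_lt_two : (1 : ℝ) < 2)).1 (lt_of_mul_lt_mul_left h2 hr.le)
  rw [ht, pow_succ] at hspec
  refine le_trans ?_ (Finset.single_le_sum (f := fun t => (X.splitsAt i j (r * 2 ^ t)).indicator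
    (fun _ => ENNReal.ofReal (12 * d * X.eps * r * 2 ^ t)) ω) (fun _ _ => zero_le)
    (Finset.mem_range.2 htT))
  rw [Set.indicator_of_mem]
  · refine ENNReal.ofReal_le_ofReal ?_
    calc 6 * d * X.eps * (X.node ω a).cell.side ≤ 6 * d * X.eps * (r * (2 ^ t * 2)) := by gcongr
      _ = _ := by ring
  · exact ⟨he, a, ha, hlt, by linarith⟩

/-- At each scale the cost `12dεr·2^t` meets the probability bound `6d/2^t`, so all scales
contribute the same `72d²εr`. The leading term keeps the exact mass of the event for the later
division. -/
theorem setLIntegral_graphDist_le {i j : Fin n} (hij : i ≠ j) {T : ℕ} (hT : (n : ℝ) ^ 4 ≤ 2 ^ T) :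
    ∫⁻ ω in X.avoidsMoats, X.graphDist ω (.point i) (.point j) ∂shiftMeasure n d ≤
      ENNReal.ofReal (dist (X.pt i) (X.pt j)) * shiftMeasure n d X.avoidsMoats +
      ENNReal.ofReal (6 * d * X.eps * dist (X.pt i) (X.pt j) * (1 + 12 * d * T)) := by
  have he0 := X.eps_pos
  have hr : 0 < dist (X.pt i) (X.pt j) := dist_pos.2 (hX.inj.ne hij)
  have hmeas : ∀ t : ℕ, Measurable ((X.splitsAt i j (dist (X.pt i) (X.pt j) * 2 ^ t)).indicator
        (fun _ => ENNReal.ofReal (12 * d * X.eps * dist (X.pt i) (X.pt j) * 2 ^ t))) :=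
    fun t => measurable_const.indicator (X.measurableSet_splitsAt _ _ _)
  have hbound : ∀ t : ℕ, ∫⁻ ω in X.avoidsMoats,
      (X.splitsAt i j (dist (X.pt i) (X.pt j) * 2 ^ t)).indicator
        (fun _ => ENNReal.ofReal (12 * d * X.eps * dist (X.pt i) (X.pt j) * 2 ^ t)) ω
        ∂shiftMeasure n d ≤ ENNReal.ofReal (72 * d * d * X.eps * dist (X.pt i) (X.pt j)) := by
    intro t
    refine (setLIntegral_le_lintegral _ _).trans ?_
    refine (lintegral_indicator_const_le _ _).trans ?_
    have hσ : 0 < dist (X.pt i) (X.pt j) * 2 ^ t := by positivity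
    refine (mul_le_mul_right (hX.measure_splits_le i j hσ) _).trans ?_
    rw [← ENNReal.ofReal_natCast d, ← ENNReal.ofReal_mul (by positivity),
      ← ENNReal.ofReal_mul (by positivity)]
    refine ENNReal.ofReal_le_ofReal (le_of_eq ?_)
    field_simp
    ring
  calc ∫⁻ ω in X.avoidsMoats, X.graphDist ω (.point i) (.point j) ∂shiftMeasure n d
      ≤ ∫⁻ ω in X.avoidsMoats, ENNReal.ofReal (dist (X.pt i) (X.pt j)) +
      (ENNReal.ofReal (6 * d * X.eps * dist (X.pt i) (X.pt j)) +
      ∑ t ∈ Finset.range T, (X.splitsAt i j (dist (X.pt i) (X.pt j) * 2 ^ t)).indicator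
        (fun _ => ENNReal.ofReal (12 * d * X.eps * dist (X.pt i) (X.pt j) * 2 ^ t)) ω)
        ∂shiftMeasure n d := by
        refine lintegral_mono_ae ?_
        filter_upwards [ae_restrict_mem X.measurableSet_avoidsMoats,
          ae_restrict_of_ae (ae_mem_unitShifts n d)] with ω he hω
        exact hX.graphDist_le_sum hω he hij hT
    _ = ENNReal.ofReal (dist (X.pt i) (X.pt j)) * shiftMeasure n d X.avoidsMoats +
        (ENNReal.ofReal (6 * d * X.eps * dist (X.pt i) (X.pt j)) *
          shiftMeasure n d X.avoidsMoats +
        ∑ t ∈ Finset.range T, ∫⁻ ω in X.avoidsMoats,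
      (X.splitsAt i j (dist (X.pt i) (X.pt j) * 2 ^ t)).indicator
        (fun _ => ENNReal.ofReal (12 * d * X.eps * dist (X.pt i) (X.pt j) * 2 ^ t)) ω
        ∂shiftMeasure n d) := by
        rw [lintegral_add_left measurable_const, lintegral_add_left measurable_const,
          lintegral_finsetSum _ fun t _ => hmeas t]
        simp
    _ ≤ ENNReal.ofReal (dist (X.pt i) (X.pt j)) * shiftMeasure n d X.avoidsMoats +
        (ENNReal.ofReal (6 * d * X.eps * dist (X.pt i) (X.pt j)) * 1 +
        ∑ _t ∈ Finset.range T, ENNReal.ofReal (72 * d * d * X.eps * dist (X.pt i) (X.pt j))) := by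
        gcongr with t _
        · exact prob_le_one
        · exact hbound t
    _ = _ := by
        rw [mul_one, Finset.sum_const, Finset.card_range, nsmul_eq_mul,
          ← ENNReal.ofReal_natCast T, ← ENNReal.ofReal_mul (by positivity),
          ← ENNReal.ofReal_add (by positivity) (by positivity)]
        congr 2
        ring

end Regular

theorem clog_two_le {n : ℕ} (hn : 2 ≤ n) : (Nat.clog 2 n : ℝ) ≤ 1 + 2 * Real.log n := by
  have hlt : 2 ^ (Nat.clog 2 n).pred < n := Nat.pow_pred_clog_lt_self one_lt_two (by omega)
  have hpos : 0 < Nat.clog 2 n := Nat.clog_pos one_lt_two (by omega)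
  obtain ⟨q, hq⟩ : ∃ q, Nat.clog 2 n = q + 1 := ⟨_, (Nat.succ_pred hpos.ne').symm⟩
  rw [hq, Nat.pred_succ] at hlt
  have h1 : ((2 : ℝ) ^ q) < n := by exact_mod_cast hlt
  have h2 := Real.log_lt_log (by positivity) h1
  rw [Real.log_pow] at h2
  have h3 := Real.log_two_gt_d9
  rw [hq]
  push_cast
  nlinarith [(Nat.cast_nonneg q : (0 : ℝ) ≤ q)]

theorem half_le_log {n : ℕ} (hn : 2 ≤ n) : 1 / 2 ≤ Real.log n := by
  have h1 : Real.log 2 ≤ Real.log n :=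
    Real.log_le_log (by norm_num) (by exact_mod_cast hn)
  linarith [Real.log_two_gt_d9]

theorem k_le_of_log_le (X : Config n d) {y : ℝ} (h : Real.log (1 / X.eps) ≤ y) :
    (X.k : ℝ) ≤ 2 * y := by
  unfold eps at h
  rw [one_div_one_div, Real.log_pow] at h
  have h3 := Real.log_two_gt_d9
  nlinarith [(Nat.cast_nonneg X.k : (0 : ℝ) ≤ X.k)]

/-- For many points, the moats are avoided with probability at least one half. -/
theorem eventually_half_le_measure (d : ℕ) {f : ℕ → ℝ}
    (hf : Tendsto (fun n : ℕ => f n / n) atTop (𝓝 0)) :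
    ∀ᶠ n : ℕ in atTop, ∀ X : Config n d, X.Regular → Real.log (1 / X.eps) ≤ f n →
      1 / 2 ≤ shiftMeasure n d X.avoidsMoats := by
  have hlog : Tendsto (fun n : ℕ => Real.log n / n) atTop (𝓝 0) :=
    (Real.isLittleO_log_id_atTop.tendsto_div_nhds_zero).comp tendsto_natCast_atTop_atTop
  have hinv : Tendsto (fun n : ℕ => 1 / (n : ℝ)) atTop (𝓝 0) := tendsto_one_div_atTop_nhds_zero_nat
  have hlim : Tendsto (fun n : ℕ => 12 * d * (4 * (f n / n) + 16 * (Real.log n / n) +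
      12 * (1 / (n : ℝ)))) atTop (𝓝 0) := by
    have := (((hf.const_mul 4).add (hlog.const_mul 16)).add (hinv.const_mul 12)).const_mul
      (12 * (d : ℝ))
    simpa using this
  filter_upwards [hlim.eventually (ge_mem_nhds (by norm_num : (0 : ℝ) < 1 / 2))]
    with n hn X hX hk
  have hn0 := hX.cast_pos
  have hk' := X.k_le_of_log_le hk
  have hm := clog_two_le hX.two_le
  -- The `k` cancels ε, `8 * clog` gives at least n^8, and the final 2 covers the factor 3.
  have hL : 3 * (n : ℝ) ^ 8 ≤ X.eps * 2 ^ (X.k + 8 * Nat.clog 2 n + 2) := by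
    have h1 : (n : ℝ) ≤ 2 ^ Nat.clog 2 n := by
      exact_mod_cast Nat.le_pow_clog one_lt_two n
    have h2 : X.eps * 2 ^ (X.k + 8 * Nat.clog 2 n + 2) = 4 * (2 ^ Nat.clog 2 n) ^ 8 := by
      unfold eps
      rw [pow_add, pow_add, ← pow_mul, mul_comm (Nat.clog 2 n)]
      field_simp
      norm_num
    rw [h2]
    have := pow_le_pow_left₀ hn0.le h1 8
    have h3 : (0 : ℝ) < (n : ℝ) ^ 8 := by positivity
    linarith
  have hcompl : shiftMeasure n d X.avoidsMoatsᶜ ≤ 1 / 2 := by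
    refine (hX.measure_compl_avoidsMoats_le hL).trans ?_
    have e : (1 / 2 : ℝ≥0∞) = ENNReal.ofReal (1 / 2) := by
      rw [ENNReal.ofReal_div_of_pos (by norm_num)]
      simp
    rw [e]
    refine ENNReal.ofReal_le_ofReal (le_trans ?_ hn)
    push_cast
    set k : ℝ := (X.k : ℝ)
    set m : ℝ := (Nat.clog 2 n : ℝ)
    have hk0 : 0 ≤ k := Nat.cast_nonneg _
    have h1n : (1 : ℝ) ≤ n := by linarith [hX.two_le_cast]
    -- Four powers of n in the moat width against three from the union bound leave (k + log n)/n.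
    calc n * (n * (n * (k + 8 * m + 2 + 1) + k + 1)) * (d * (12 / (n : ℝ) ^ 4))
        ≤ n * (n * (n * (k + 8 * m + 2 + 1) + n * (k + 1))) * (d * (12 / (n : ℝ) ^ 4)) := by
          have h2 : k + 1 ≤ n * (k + 1) := by nlinarith
          rw [add_assoc (_ * _) k 1]
          gcongr
      _ = 12 * d * ((2 * k + 8 * m + 4) / n) := by
          field_simp
          ring
      _ ≤ 12 * d * ((4 * f n + 16 * Real.log n + 12) / n) := by
          refine mul_le_mul_of_nonneg_left (div_le_div_of_nonneg_right ?_ hn0.le) (by positivity)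
          linarith
      _ = _ := by ring
  have hadd := prob_add_prob_compl (μ := shiftMeasure n d) X.measurableSet_avoidsMoats
  by_contra! hlt
  have : shiftMeasure n d X.avoidsMoats + shiftMeasure n d X.avoidsMoatsᶜ < 1 / 2 + 1 / 2 :=
    ENNReal.add_lt_add_of_lt_of_le (by simp) hlt hcompl
  rw [hadd, ENNReal.add_halves] at this
  exact lt_irrefl _ this

namespace Regular

variable (hX : X.Regular)
include hX

theorem lintegral_cond_le_of_half_le (h : 1 / 2 ≤ shiftMeasure n d X.avoidsMoats) {i j : Fin n}
    (hij : i ≠ j) :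
    ∫⁻ ω, X.graphDist ω (.point i) (.point j)
        ∂(ProbabilityTheory.cond (shiftMeasure n d) X.avoidsMoats) ≤
      ENNReal.ofReal ((1 + 24 * d * (1 + 96 * d) * X.eps * Real.log n) *
        dist (X.pt i) (X.pt j)) := by
  have hT : (n : ℝ) ^ 4 ≤ 2 ^ (4 * Nat.clog 2 n) := by
    have h1 : (n : ℝ) ≤ 2 ^ Nat.clog 2 n := by exact_mod_cast Nat.le_pow_clog one_lt_two n
    rw [mul_comm, pow_mul]
    exact pow_le_pow_left₀ hX.cast_pos.le h1 4
  have hint := hX.setLIntegral_graphDist_le hij hT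
  have hlog := half_le_log hX.two_le
  have hclog := clog_two_le hX.two_le
  have he0 := X.eps_pos
  have hr : 0 < dist (X.pt i) (X.pt j) := dist_pos.2 (hX.inj.ne hij)
  have hne0 : shiftMeasure n d X.avoidsMoats ≠ 0 := by
    intro h0
    rw [h0] at h
    simp at h
  unfold ProbabilityTheory.cond
  rw [lintegral_smul_measure, smul_eq_mul]
  refine (mul_le_mul_right hint _).trans ?_
  -- The leading term is divided by exactly its own mass, so its coefficient stays 1; only the error
  -- term pays the factor 2.
  rw [mul_add, mul_left_comm, ENNReal.inv_mul_cancel hne0 (measure_ne_top _ _), mul_one]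
  have hinv : (shiftMeasure n d X.avoidsMoats)⁻¹ ≤ ENNReal.ofReal 2 := by
    rw [ENNReal.inv_le_iff_inv_le]
    refine le_trans (le_of_eq ?_) h
    simp
  refine (add_le_add_right (mul_le_mul_left hinv _) _).trans ?_
  rw [← ENNReal.ofReal_mul (by norm_num), ← ENNReal.ofReal_add hr.le (by positivity)]
  refine ENNReal.ofReal_le_ofReal ?_
  push_cast
  have key : 1 + 12 * d * (4 * (Nat.clog 2 n : ℝ)) ≤ 2 * (1 + 96 * d) * Real.log n := by
    have hd : (0 : ℝ) ≤ d := Nat.cast_nonneg d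
    nlinarith [mul_le_mul_of_nonneg_left hclog hd, mul_le_mul_of_nonneg_left hlog hd]
  have := mul_le_mul_of_nonneg_left key
    (by positivity : 0 ≤ 2 * (6 * d * X.eps * dist (X.pt i) (X.pt j)))
  linarith

/-- The deterministic stretch bound suffices, with `1 / 2 ≤ log n` supplying the logarithm. No lower
bound on the probability of the event is needed: the conditional measure has mass at most one. -/
theorem lintegral_cond_le_of_le {N : ℕ} (hN : n ≤ N) {i j : Fin n} (hij : i ≠ j) :
    ∫⁻ ω, X.graphDist ω (.point i) (.point j)
        ∂(ProbabilityTheory.cond (shiftMeasure n d) X.avoidsMoats) ≤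
      ENNReal.ofReal ((1 + 12 * d * (N : ℝ) ^ 4 * X.eps * Real.log n) *
        dist (X.pt i) (X.pt j)) := by
  have he0 := X.eps_pos
  have hlog := half_le_log hX.two_le
  have hN' : (n : ℝ) ^ 4 ≤ (N : ℝ) ^ 4 := by gcongr
  calc _ ≤ ∫⁻ _, ENNReal.ofReal ((1 + 12 * d * (N : ℝ) ^ 4 * X.eps * Real.log n) *
        dist (X.pt i) (X.pt j))
        ∂(ProbabilityTheory.cond (shiftMeasure n d) X.avoidsMoats) := by
        refine lintegral_mono_ae ?_
        have hunit : ∀ᵐ ω ∂ProbabilityTheory.cond (shiftMeasure n d) X.avoidsMoats,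
            ω ∈ unitShifts n d :=
          cond_absolutelyContinuous.ae_le (ae_mem_unitShifts n d)
        filter_upwards [ae_cond_mem X.measurableSet_avoidsMoats, hunit] with ω he hω
        refine (hX.graphDist_le_of_avoidsMoats hω he hij).trans (ENNReal.ofReal_le_ofReal ?_)
        gcongr ?_ * _
        have h1 : 6 * d * X.eps * (n : ℝ) ^ 4 ≤ 6 * d * X.eps * (N : ℝ) ^ 4 := by gcongr
        have h2 := mul_le_mul_of_nonneg_left hlog
          (by positivity : 0 ≤ 12 * d * (N : ℝ) ^ 4 * X.eps)
        linarith
    _ ≤ _ := by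
        rw [lintegral_const]
        exact mul_le_of_le_one_right zero_le prob_le_one

end Regular

theorem graphDist_self (X : Config n d) (ω : Shifts n d) (u : Vertex n d X.k) :
    X.graphDist ω u u = 0 := by
  have := (Joined.refl (X := X) (ω := ω) u).graphDist_le
  simpa using this

end Config

end

end NetGraph

theorem mainTheorem2 (d : ℕ) (f : ℕ → ℝ)
    (hf : Tendsto (fun n : ℕ => f n / n) atTop (𝓝 0)) :
    ∃ K : ℝ, 0 < K ∧ ∀ (n : ℕ) (X : NetGraph.Config n d),
      Function.Injective X.pt →
      (∀ S : Finset (Fin n), S.Nonempty → NetGraph.IsMinBoundingCube X.pt S (X.box S)) →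
      Real.log (1 / X.eps) ≤ f n →
      MeasurableSet X.avoidsMoats ∧
      ∀ i j : Fin n,
        AEMeasurable (fun ω => X.graphDist ω (.point i) (.point j))
          (ProbabilityTheory.cond (NetGraph.shiftMeasure n d) X.avoidsMoats) ∧
        ∫⁻ ω, X.graphDist ω (.point i) (.point j)
            ∂(ProbabilityTheory.cond (NetGraph.shiftMeasure n d) X.avoidsMoats) ≤
          ENNReal.ofReal ((1 + K * X.eps * Real.log n) * dist (X.pt i) (X.pt j)) := by
  obtain ⟨N, hN⟩ := eventually_atTop.1 (NetGraph.Config.eventually_half_le_measure d hf)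
  -- The sum dominates the constants of both ranges of n; the extra 1 keeps it positive even for `d
  -- = 0`.
  refine ⟨24 * d * (1 + 96 * d) + 12 * d * (N : ℝ) ^ 4 + 1, by positivity, ?_⟩
  intro n X hinj hbox hk
  refine ⟨X.measurableSet_avoidsMoats, fun i j => ⟨(X.measurable_graphDist _ _).aemeasurable, ?_⟩⟩
  by_cases hij : i = j
  · subst hij
    simp [NetGraph.Config.graphDist_self]
  have hn : 2 ≤ n := by
    by_contra! h
    exact hij (Fin.ext (by omega))
  have hX : X.Regular := ⟨hn, hinj, hbox⟩
  have he0 := X.eps_pos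
  have hlog := NetGraph.Config.half_le_log hn
  have mono : ∀ {K : ℝ}, K ≤ 24 * d * (1 + 96 * d) + 12 * d * (N : ℝ) ^ 4 + 1 →
      ENNReal.ofReal ((1 + K * X.eps * Real.log n) * dist (X.pt i) (X.pt j)) ≤
      ENNReal.ofReal ((1 + (24 * d * (1 + 96 * d) + 12 * d * (N : ℝ) ^ 4 + 1) * X.eps *
        Real.log n) * dist (X.pt i) (X.pt j)) := by
    intro K hK
    have : 0 ≤ Real.log n := by linarith
    gcongr
  rcases le_total N n with h | h
  · refine (hX.lintegral_cond_le_of_half_le (hN n h X hX hk) hij).trans (mono ?_)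
    have : (0 : ℝ) ≤ 12 * d * (N : ℝ) ^ 4 := by positivity
    linarith
  · refine (hX.lintegral_cond_le_of_le h hij).trans (mono ?_)
    have : (0 : ℝ) ≤ 24 * d * (1 + 96 * d) := by positivity
    linarith
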